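/- Let $D$ be a knot diagram with $c\ge 1$ crossings. At each crossing, with overstrand colored $y$ and understrands colored $x$ and $z$, write the equation $x+z-2y=0$ (or its negative). $D$ has exactly $c$ strands; after numbering crossings and strands these equations form a $c\times c$ integer matrix $\tilde C$, a pre-coloring matrix. Shade the regions of $D$ in checkerboard fashion and number the $s$ shaded regions $R_1,\dots,R_s$. Let $\eta(q)=-1$ if the overstrand at the crossing $q$, rotated counterclockwise, first sweeps the shaded corners, and $\eta(q)=+1$ otherwise. The pre-Goeritz matrix $\tilde G$ is the $s\times s$ matrix with $\tilde G_{ij}=\sum\eta(q)$ for $i\ne j$, summed over the crossings $q$ at which $R_i$ and $R_j$ meet, and $\tilde G_{ii}=-\sum_{j\ne i}\tilde G_{ij}$. Let $C$ and $G$ be obtained from $\tilde C$ and $\tilde G$ by deleting the first row and the first column; the strand $\alpha_1$ numbered first and the region $R_1$ may be arbitrary (for instance $\alpha_1$ may partially bound $R_1$), and so may the crossing numbered first. Write $\mathrm{Nul}$ for the null space modulo $n$, and call a solution non-trivial if it is non-zero. Then for every $n\in\mathbb N$ there are bijections between the following sets: (i) non-trivial solutions $\tilde v\in(\mathbb Z/n\mathbb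 Z)^c$ of $\tilde C$ with first entry $0$; (ii) non-trivial solutions $v\in(\mathbb Z/n\mathbb Z)^{c-1}$ of $C$; (iii) non-trivial solutions $w\in(\mathbb Z/n\mathbb Z)^{s-1}$ of $G$; (iv) non-trivial solutions $\tilde w\in(\mathbb Z/n\mathbb Z)^s$ of $\tilde G$ with first entry $0$. Deleting the first entry is a bijection from (i) to (ii) and from (iv) to (iii). The bijection from (ii) to (iii) is the restriction of a $\mathbb Z/n\mathbb Z$-linear isomorphism $\mathrm{Nul}(C)\cong\mathrm{Nul}(G)$, under which $v\mapsto w$ satisfies: if the strands are colored by $\tilde v=(0,v)$ and $\tilde w=(0,w)$, then for all $i,j$ and every generic arc from $R_i$ to $R_j$ the alternating sum (beginning with $+$) of the colors of the strands that the arc crosses equals $\tilde w_j-\tilde w_i$. In particular, for prime $n$ the null spaces of $C$ and $G$ modulo $n$ have equal dimension. As a consequence the coloring determinant equals the Goeritz determinant: deleting any row and any column of $\tilde C$, and any row and any column of $\tilde G$, leaves matrices whose determinants have the same absolute value. -/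

import Mathlib

/-- Half-edges of a diagram with `c` crossings: the four arms of crossing `k` are `(k, 0)`, `(k, 1)`,
`(k, 2)`, `(k, 3)` in counterclockwise order; the arms `0`, `2` form the underpass and the arms
`1`, `3` form the overpass. -/
abbrev Dart (c : ℕ) : Type := Fin c × ZMod 4

/-- The next arm of the same crossing in counterclockwise direction. -/
def Dart.rotate (c : ℕ) : Equiv.Perm (Dart c) :=
  Equiv.prodCongr (Equiv.refl (Fin c)) (Equiv.addRight (1 : ZMod 4))

/-- The opposite arm of the same crossing. -/
def Dart.opp {c : ℕ} (d : Dart c) : Dart c := (d.1, d.2 + 2)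

/-- The face permutation of the combinatorial map whose vertices are the crossings and whose edges
are given by `edge`. The dart `d` stands for the corner between `d` and `rotate d`, which lies on the
left of `d` when `d` is directed away from its crossing. Walking along the edge of `d` with this
corner on the left, one meets next the corner between `rotate⁻¹ (edge d)` and `edge d`. -/
def facePerm {c : ℕ} (edge : Equiv.Perm (Dart c)) : Equiv.Perm (Dart c) :=
  (Dart.rotate c)⁻¹ * edge

/-- The faces of this combinatorial map: the cycles of the face permutation. -/
abbrev Face {c : ℕ} (edge : Equiv.Perm (Dart c)) : Type :=
  Quotient (Equiv.Perm.SameCycle.setoid (facePerm edge))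

/-- A knot diagram with `c` crossings, `c ≥ 1`, up to isotopy of the sphere: a four-valent
combinatorial map of genus zero with over/under information and with one link component.
(There is no such diagram for `c = 0`, as `planar` fails.) -/
structure KnotDiagram (c : ℕ) where
  /-- The other end of the edge that starts at the given arm. -/
  edge : Equiv.Perm (Dart c)
  edge_edge : ∀ d, edge (edge d) = d
  edge_ne : ∀ d, edge d ≠ d
  /-- Travelling along edges and straight through crossings one reaches every arm:
  the link has one component. (In particular the diagram is connected.) -/
  knot : ∀ d e, Relation.EqvGen (fun a b => b = edge a ∨ b = Dart.opp a) d e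
  /-- Euler's formula for the sphere: there are `c` vertices and `2 * c` edges. -/
  planar : Nat.card (Face edge) + c = 2 * c + 2

namespace KnotDiagram

variable {c : ℕ} (D : KnotDiagram c)

/-- The regions of the diagram. -/
abbrev Region : Type := Face D.edge

/-- The region that contains the corner between `d` and the next arm counterclockwise; equivalently,
the region on the left of `d` directed away from its crossing. The region on the right of `d` is
`D.region (D.edge d)`. -/
def region (d : Dart c) : D.Region := Quotient.mk _ d

/-- Two darts belong to the same strand if one gets from one to the other along edges and through
overpasses. -/
def strandSetoid : Setoid (Dart c) :=
  Relation.EqvGen.setoid (fun a b => b = D.edge a ∨ (a.2 = 1 ∧ b = Dart.opp a))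

/-- The strands of the diagram, each running from an underpass to an underpass. -/
def Strand : Type := Quotient D.strandSetoid

/-- The strand to which a dart belongs. -/
def strand (d : Dart c) : D.Strand := Quotient.mk D.strandSetoid d

open Classical in
/-- The pre-coloring matrix for the numbering `σ` of the strands. Row `k` is the equation
`x + z - 2 * y = 0` of crossing `k`, or its negative, according to the sign `ε k`. -/
noncomputable def preColoringMatrix (σ : Fin c ≃ D.Strand) (ε : Fin c → ℤˣ) :
    Matrix (Fin c) (Fin c) ℤ :=
  Matrix.of fun k a => (ε k : ℤ) *
    ((if σ a = D.strand (k, 0) then 1 else 0) + (if σ a = D.strand (k, 2) then 1 else 0)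
      - 2 * (if σ a = D.strand (k, 1) then 1 else 0))

/-- A checkerboard coloring of the regions: of the two sides of every edge exactly one is shaded. -/
structure Checkerboard where
  shaded : D.Region → Prop
  alternate : ∀ d, shaded (D.region d) ↔ ¬ shaded (D.region (D.edge d))

open Classical in
/-- The sign of a crossing: it is `-1` if the overpass, turned counterclockwise, sweeps the shaded
corners first, and `1` if it sweeps the unshaded corners first. -/
noncomputable def Checkerboard.sign {D : KnotDiagram c} (S : D.Checkerboard) (k : Fin c) : ℤ :=
  if S.shaded (D.region (k, 1)) then -1 else 1

/-- The regions `R` and `R'` come together at the crossing `k`, in opposite corners. -/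
def MeetAt (k : Fin c) (R R' : D.Region) : Prop :=
  ∃ a : ZMod 4, D.region (k, a) = R ∧ D.region (k, a + 2) = R'

open Classical in
/-- The off-diagonal entries of the pre-Goeritz matrix. -/
noncomputable def Checkerboard.goeritzEntry {D : KnotDiagram c} (S : D.Checkerboard)
    (R R' : D.Region) : ℤ :=
  ∑ k : Fin c, if D.MeetAt k R R' then S.sign k else 0

/-- The pre-Goeritz matrix for the numbering `ρ` of the shaded regions. -/
noncomputable def Checkerboard.preGoeritzMatrix {D : KnotDiagram c} (S : D.Checkerboard) {s : ℕ}
    (ρ : Fin s ≃ {R : D.Region // S.shaded R}) : Matrix (Fin s) (Fin s) ℤ :=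
  Matrix.of fun i j =>
    if i = j then - ∑ l ∈ Finset.univ.erase i, S.goeritzEntry (ρ i).1 (ρ l).1
    else S.goeritzEntry (ρ i).1 (ρ j).1

/-- Generic arcs between regions, recorded by the edges that they cross, in their order:
`cross d γ` starts on the left of `d`, crosses the edge of `d`, and continues as `γ`. -/
inductive Arc : D.Region → D.Region → Type
  | nil (R : D.Region) : Arc R R
  | cross (d : Dart c) {R : D.Region} (γ : Arc (D.region (D.edge d)) R) : Arc (D.region d) R

/-- The alternating sum, beginning with a positive sign, of the colors of the strands that an arc
crosses. -/
def Arc.altSum {D : KnotDiagram c} {A : Type} [AddCommGroup A] (x : D.Strand → A) :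
    {R R' : D.Region} → D.Arc R R' → A
  | _, _, .nil _ => 0
  | _, _, .cross d γ => x (D.strand d) - γ.altSum x

end KnotDiagram

/-- Delete the first row and the first column. -/
def deleteFirst {m : ℕ} (A : Matrix (Fin (m + 1)) (Fin (m + 1)) ℤ) : Matrix (Fin m) (Fin m) ℤ :=
  A.submatrix Fin.succ Fin.succ

/-- The null space of an integer matrix modulo `n`. -/
def nul (n : ℕ) {m : ℕ} (A : Matrix (Fin m) (Fin m) ℤ) : Submodule (ZMod n) (Fin m → ZMod n) :=
  LinearMap.ker (A.map (Int.cast : ℤ → ZMod n)).mulVecLin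

/-!
The proof passes through colorings of the regions. Say that values `h` on the regions solve the
crossing equations if at every crossing the sums of the values on the two sides of the overpass
agree before and after the crossing. Such values color each strand by the sum of the values on its
two sides, and these colors solve the coloring equations. After normalization at one shaded region
and one strand, the solutions `h` form a space (`dehnSpace`) that maps isomorphically to both null
spaces: to `Nul(C)` by the induced strand colors, and to `Nul(G)` by the negatives of the values
on the shaded regions. The rule for arcs is then a telescoping sum (`Arc.altSum_eq`).

Both surjectivity claims say that the sphere has no first homology, for two different
cellulations. A coloring, with signs from the shading, is a divergence-free vector on the
projection, hence the coboundary of a function on the regions (`exists_region_values`). A solution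
of the Goeritz equations gives a divergence-free vector on the shaded checkerboard graph, because
the Goeritz matrix is a weighted Laplacian of this graph (`preGoeritzMatrix_mulVec`), hence it is
the coboundary of a function on the unshaded regions (`exists_unshaded_values`). The homological
fact is `exists_incidence_mulVec_eq`: for two connected graphs with the same edges, such that
coboundaries on the first are divergence-free on the second and the Euler characteristic is `2`,
the converse holds modulo every `n`. Over the rationals this is a count of dimensions;
connectivity of the two graphs gives the passage to the integers and from there to the integers
modulo `n`.

The rows of the pre-coloring matrix, multiplied by the signs of the crossings, have sum zero,
because the two ends of an edge have opposite shading on their left (`sum_sign_mul_eq_zero`).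
Therefore one equation may be dropped, and all minors of corank one agree up to sign. The same
holds for the pre-Goeritz matrix, which is symmetric with vanishing row sums. Finally a square
integer matrix with non-zero determinant `d` has exactly `|d|` null vectors modulo each positive
multiple of `d`, while the determinant is zero exactly if there are non-zero integral null
vectors, so the isomorphisms of the null spaces for all `n`, including `n = 0`, give the equality
of the determinants.
-/

/-! ### Exactness for a pair of dual graphs -/

section DualGraphs

open Matrix

variable {E F V : Type*}

/-- The oriented incidence matrix of the graph with vertex type `F` whose edge `e : E` runs from
`r e` to `l e`; loops and multiple edges are allowed. Multiplication by it is the coboundary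
`h ↦ (e ↦ h (l e) - h (r e))`; multiplication by its transpose is the divergence. -/
def incidence (R : Type*) [Ring R] [DecidableEq F] (l r : E → F) : Matrix E F R :=
  Matrix.of fun e f => (if l e = f then 1 else 0) - (if r e = f then 1 else 0)

/-- The graph with edges from `r e` to `l e` is connected: a property of vertices that is passed
along the edges holds everywhere as soon as it holds somewhere. -/
def GraphConnected (l r : E → F) : Prop :=
  ∀ P : F → Prop, (∀ e, P (l e) ↔ P (r e)) → ∀ f f', P f → P f'

theorem incidence_mulVec [Fintype F] {R : Type*} [Ring R] [DecidableEq F] (l r : E → F)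
    (h : F → R) (e : E) :
    (incidence R l r *ᵥ h) e = h (l e) - h (r e) := by
  simp [incidence, mulVec, dotProduct, sub_mul, Finset.sum_sub_distrib]

theorem incidence_transpose_mulVec [Fintype E] {R : Type*} [Ring R] [DecidableEq F] (l r : E → F)
    (w : E → R) (f : F) : ((incidence R l r)ᵀ *ᵥ w) f =
      ∑ e, ((if l e = f then w e else 0) - (if r e = f then w e else 0)) := by
  simp [incidence, mulVec, dotProduct, sub_mul]

theorem incidence_map_intCast {R : Type*} [Ring R] [DecidableEq F] (l r : E → F) :
    (incidence ℤ l r).map (Int.cast : ℤ → R) = incidence R l r := by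
  ext e f
  simp [incidence]

theorem GraphConnected.eq_of_incidence_mulVec_eq_zero [Fintype F] {R : Type*} [Ring R]
    [DecidableEq F] {l r : E → F} (hc : GraphConnected l r) {h : F → R}
    (hh : incidence R l r *ᵥ h = 0)
    (f f' : F) : h f' = h f := by
  refine hc (fun g => h g = h f) (fun e => ?_) f f' rfl
  have := congrFun hh e
  rw [incidence_mulVec, Pi.zero_apply, sub_eq_zero] at this
  rw [this]

theorem GraphConnected.card_le_rank_add_one [Fintype E] [Fintype F] [DecidableEq F] {l r : E → F}
    (hc : GraphConnected l r) : Fintype.card F ≤ (incidence ℚ l r).rank + 1 := by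
  have h1 := LinearMap.finrank_range_add_finrank_ker (incidence ℚ l r).mulVecLin
  rw [Module.finrank_fintype_fun_eq_card] at h1
  rw [Matrix.rank, ← h1]
  refine Nat.add_le_add_left ?_ _
  have h2 : LinearMap.ker (incidence ℚ l r).mulVecLin ≤ Submodule.span ℚ {fun _ => (1 : ℚ)} := by
    intro h hh
    rw [LinearMap.mem_ker, mulVecLin_apply] at hh
    rw [Submodule.mem_span_singleton]
    rcases isEmpty_or_nonempty F with hF | ⟨⟨f⟩⟩
    · exact ⟨0, Subsingleton.elim _ _⟩
    · exact ⟨h f, funext fun f' => by simp [hc.eq_of_incidence_mulVec_eq_zero hh f f']⟩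
  exact (Submodule.finrank_mono h2).trans ((finrank_span_le_card _).trans (by simp))

/-- Over `ℚ` exactness is a count of dimensions: Euler's formula makes the dimension of the space
of divergence-free vectors equal to that of the space of coboundaries. -/
theorem exists_incidence_mulVec_eq_rat [Fintype E] [Fintype F] [Fintype V] [DecidableEq F]
    [DecidableEq V] {l r : E → F} {a b : E → V}
    (hF : GraphConnected l r) (hV : GraphConnected a b)
    (hcard : Fintype.card E + 2 = Fintype.card F + Fintype.card V)
    (hcomp : (incidence ℤ a b)ᵀ * incidence ℤ l r = 0) (w : E → ℚ)
    (hw : (incidence ℚ a b)ᵀ *ᵥ w = 0) : ∃ h, incidence ℚ l r *ᵥ h = w := by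
  have hcompQ : (incidence ℚ a b)ᵀ * incidence ℚ l r = 0 := by
    have := congrArg (fun M => M.map (Int.castRingHom ℚ)) hcomp
    simp only [Matrix.map_mul, transpose_map] at this
    simpa [incidence_map_intCast] using this
  have hle : LinearMap.range (incidence ℚ l r).mulVecLin ≤
      LinearMap.ker ((incidence ℚ a b)ᵀ).mulVecLin := by
    rintro _ ⟨h, rfl⟩
    rw [LinearMap.mem_ker, mulVecLin_apply, mulVecLin_apply, mulVec_mulVec, hcompQ, zero_mulVec]
  have h1 := LinearMap.finrank_range_add_finrank_ker ((incidence ℚ a b)ᵀ).mulVecLin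
  rw [Module.finrank_fintype_fun_eq_card] at h1
  have h2 : Fintype.card V ≤
      Module.finrank ℚ (LinearMap.range ((incidence ℚ a b)ᵀ).mulVecLin) + 1 := by
    have := hV.card_le_rank_add_one
    rwa [← Matrix.rank_transpose] at this
  have h3 : Fintype.card F ≤ Module.finrank ℚ (LinearMap.range (incidence ℚ l r).mulVecLin) + 1 :=
    hF.card_le_rank_add_one
  have heq := Submodule.eq_of_le_of_finrank_le hle (by omega)
  have hmem : w ∈ LinearMap.ker ((incidence ℚ a b)ᵀ).mulVecLin := hw
  rw [← heq] at hmem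
  exact hmem

/-- A rational potential with integral coboundary is integral up to a constant, because the graph
is connected. -/
theorem exists_incidence_mulVec_eq_int [Fintype E] [Fintype F] [Fintype V] [DecidableEq F]
    [DecidableEq V] {l r : E → F} {a b : E → V}
    (hF : GraphConnected l r) (hV : GraphConnected a b)
    (hcard : Fintype.card E + 2 = Fintype.card F + Fintype.card V)
    (hcomp : (incidence ℤ a b)ᵀ * incidence ℤ l r = 0) (w : E → ℤ)
    (hw : (incidence ℤ a b)ᵀ *ᵥ w = 0) : ∃ h, incidence ℤ l r *ᵥ h = w := by
  rcases isEmpty_or_nonempty F with hFe | ⟨⟨f₀⟩⟩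
  · have : IsEmpty E := ⟨fun e => hFe.false (l e)⟩
    exact ⟨0, Subsingleton.elim _ _⟩
  obtain ⟨h, hh⟩ := exists_incidence_mulVec_eq_rat hF hV hcard hcomp (fun e => (w e : ℚ)) <| by
    ext v
    have := congrArg (Int.cast : ℤ → ℚ) (congrFun hw v)
    rw [incidence_transpose_mulVec] at this ⊢
    push_cast at this
    simpa using this
  have hh' : ∀ e, h (l e) - h (r e) = w e := fun e => by
    rw [← incidence_mulVec, hh]
  have hz : ∀ f, ∃ z : ℤ, h f - h f₀ = z := fun f => by
    refine hF (fun f => ∃ z : ℤ, h f - h f₀ = z) (fun e => ⟨?_, ?_⟩) f₀ f ⟨0, by simp⟩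
    · rintro ⟨z, hz⟩
      exact ⟨z - w e, by push_cast; linarith [hh' e]⟩
    · rintro ⟨z, hz⟩
      exact ⟨z + w e, by push_cast; linarith [hh' e]⟩
  choose z hz using hz
  refine ⟨z, funext fun e => ?_⟩
  rw [incidence_mulVec]
  have : ((z (l e) - z (r e) : ℤ) : ℚ) = w e := by
    push_cast
    rw [← hz, ← hz, ← hh' e]
    ring
  exact_mod_cast this

theorem sum_incidence_transpose_mulVec [Fintype E] [Fintype V] {R : Type*} [Ring R] [DecidableEq V]
    (a b : E → V)
    (w : E → R) : ∑ v, ((incidence R a b)ᵀ *ᵥ w) v = 0 := by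
  simp_rw [incidence_transpose_mulVec]
  rw [Finset.sum_comm]
  simp [Finset.sum_sub_distrib]

theorem GraphConnected.exists_incidence_transpose_mulVec_eq [Fintype E] [Fintype V] [DecidableEq V]
    {a b : E → V} (hV : GraphConnected a b) (p : V → ℤ) (hp : ∑ v, p v = 0) :
    ∃ q, (incidence ℤ a b)ᵀ *ᵥ q = p := by
  classical
  rcases isEmpty_or_nonempty V with hVe | ⟨⟨v₀⟩⟩
  · exact ⟨0, Subsingleton.elim _ _⟩
  set N := LinearMap.range ((incidence ℤ a b)ᵀ).mulVecLin with hN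
  have hedge : ∀ e, (Pi.single (a e) 1 - Pi.single (b e) 1 : V → ℤ) ∈ N := fun e => by
    refine ⟨Pi.single e 1, ?_⟩
    ext v
    simp [incidence, Pi.single_apply, eq_comm]
  have hmem : ∀ v, (Pi.single v 1 - Pi.single v₀ 1 : V → ℤ) ∈ N := fun v => by
    refine hV (fun v => (Pi.single v 1 - Pi.single v₀ 1 : V → ℤ) ∈ N) (fun e => ?_) v₀ v (by simp)
    have : (Pi.single (a e) 1 - Pi.single v₀ 1 : V → ℤ) =
      (Pi.single (a e) 1 - Pi.single (b e) 1) + (Pi.single (b e) 1 - Pi.single v₀ 1) := by abel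
    rw [this]
    exact N.add_mem_iff_right (hedge e)
  have hpN : p ∈ N := by
    have : p = ∑ v, p v • (Pi.single v 1 - Pi.single v₀ 1 : V → ℤ) := by
      simp_rw [smul_sub, Finset.sum_sub_distrib, ← Finset.sum_smul, hp]
      ext v
      simp [Pi.single_apply]
    rw [this]
    exact N.sum_mem fun v _ => N.smul_mem _ (hmem v)
  exact hpN

/-- Exactness modulo `n`: lift a divergence-free vector to the integers, where its divergence is
`n * p` with `p` of total `0`, hence `p` is a divergence and the lift can be corrected. -/
theorem exists_incidence_mulVec_eq [Fintype E] [Fintype F] [Fintype V] [DecidableEq F]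
    [DecidableEq V] {l r : E → F} {a b : E → V}
    (hF : GraphConnected l r) (hV : GraphConnected a b)
    (hcard : Fintype.card E + 2 = Fintype.card F + Fintype.card V)
    (hcomp : (incidence ℤ a b)ᵀ * incidence ℤ l r = 0) {n : ℕ} (w : E → ZMod n)
    (hw : (incidence (ZMod n) a b)ᵀ *ᵥ w = 0) : ∃ h, incidence (ZMod n) l r *ᵥ h = w := by
  classical
  choose W hW using fun e => ZMod.intCast_surjective (w e)
  have hdvd : ∀ v, (n : ℤ) ∣ ((incidence ℤ a b)ᵀ *ᵥ W) v := fun v => by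
    rw [← ZMod.intCast_zmod_eq_zero_iff_dvd]
    have := congrFun hw v
    rw [incidence_transpose_mulVec] at this ⊢
    push_cast
    simpa [hW] using this
  choose p hp using hdvd
  obtain ⟨q, hq⟩ : ∃ q, (n : ℤ) • ((incidence ℤ a b)ᵀ *ᵥ q) = (incidence ℤ a b)ᵀ *ᵥ W := by
    rcases Nat.eq_zero_or_pos n with rfl | hn
    · exact ⟨0, funext fun v => by simp [hp]⟩
    · obtain ⟨q, hq⟩ := hV.exists_incidence_transpose_mulVec_eq p <| by
        have := sum_incidence_transpose_mulVec a b W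
        simp_rw [hp, ← Finset.mul_sum] at this
        exact (mul_eq_zero.mp this).resolve_left (by exact_mod_cast hn.ne')
      exact ⟨q, funext fun v => by rw [hq, hp]; simp⟩
  obtain ⟨h, hh⟩ := exists_incidence_mulVec_eq_int hF hV hcard hcomp (W - (n : ℤ) • q) <| by
    rw [mulVec_sub, mulVec_smul, hq, sub_self]
  refine ⟨fun f => (h f : ZMod n), funext fun e => ?_⟩
  have := congrArg (Int.cast : ℤ → ZMod n) (congrFun hh e)
  rw [incidence_mulVec] at this ⊢
  simpa [hW] using this

end DualGraphs

/-! ### Minors and null spaces of integer matrices -/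

section IntegerMatrices

open Matrix

/-- If the rows have a linear relation with unit coefficients and the entries of each row sum to
zero, then all minors of corank one agree up to sign. -/
theorem abs_det_submatrix_succAbove_eq {m : ℕ} (M : Matrix (Fin (m + 1)) (Fin (m + 1)) ℤ)
    (δ : Fin (m + 1) → ℤˣ) (hrow : ∀ a, ∑ k, (δ k : ℤ) * M k a = 0)
    (hcol : ∀ k, ∑ a, M k a = 0) (k a : Fin (m + 1)) :
    |(M.submatrix k.succAbove a.succAbove).det| = |(deleteFirst M).det| := by
  have habs : ∀ u : ℤˣ, |(u : ℤ)| = 1 := fun u => Int.isUnit_iff_abs_eq.mp u.isUnit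
  have hsmul : ∀ (u : ℤˣ) (x : ℤ), |u • x| = |x| := fun u x => by
    rw [Units.smul_def, smul_eq_mul, abs_mul, habs, one_mul]
  -- rescaling the rows by units changes minors by a unit
  have hscale : ∀ k a : Fin (m + 1), |(M.submatrix k.succAbove a.succAbove).det| =
      |((Matrix.of fun i j => (δ i : ℤ) * M i j).submatrix k.succAbove a.succAbove).det| := by
    intro k a
    have : (Matrix.of fun i j => (δ i : ℤ) * M i j).submatrix k.succAbove a.succAbove =
        Matrix.of fun i j => (δ (k.succAbove i) : ℤ) * M.submatrix k.succAbove a.succAbove i j :=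
      rfl
    rw [this, det_mul_column, abs_mul, Finset.abs_prod]
    simp [habs]
  rw [hscale]
  have h0 : deleteFirst M =
      M.submatrix (0 : Fin (m + 1)).succAbove (0 : Fin (m + 1)).succAbove := by
    simp [deleteFirst, Fin.succAbove_zero]
  rw [h0, hscale]
  set M' : Matrix (Fin (m + 1)) (Fin (m + 1)) ℤ := Matrix.of fun i j => (δ i : ℤ) * M i j with hM'
  have hr := submatrix_succAbove_det_eq_negOnePow_submatrix_succAbove_det
    (M'.submatrix id a.succAbove)
    (funext fun j => (Finset.sum_apply _ _ _).trans (hrow (a.succAbove j))) k 0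
  have hc := submatrix_succAbove_det_eq_negOnePow_submatrix_succAbove_det'
    (M'.submatrix (0 : Fin (m + 1)).succAbove id)
    (fun i => by simp [hM', ← Finset.mul_sum, hcol]) a 0
  simp only [submatrix_submatrix, Function.comp_id, Function.id_comp] at hr hc
  rw [hr, hsmul, hc, hsmul]

theorem mem_nul {n m : ℕ} {A : Matrix (Fin m) (Fin m) ℤ} {v : Fin m → ZMod n} :
    v ∈ nul n A ↔ ∀ i, ∑ j, (A i j : ZMod n) * v j = 0 := by
  rw [nul, LinearMap.mem_ker, funext_iff]
  simp [mulVec, dotProduct]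

/-- The first equation follows from the others, because it has a unit coefficient in the relation
between the rows. -/
theorem cons_zero_mem_nul_iff {n m : ℕ} {M : Matrix (Fin (m + 1)) (Fin (m + 1)) ℤ}
    (δ : Fin (m + 1) → ℤˣ) (hrow : ∀ a, ∑ k, (δ k : ℤ) * M k a = 0) (v : Fin m → ZMod n) :
    (Fin.cons (α := fun _ => ZMod n) 0 v : Fin (m + 1) → ZMod n) ∈ nul n M ↔
      v ∈ nul n (deleteFirst M) := by
  have hsucc : ∀ i, ∑ j, (M i j : ZMod n) *
      (Fin.cons (α := fun _ => ZMod n) 0 v : Fin (m + 1) → ZMod n) j =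
      ∑ j : Fin m, (M i j.succ : ZMod n) * v j := fun i => by
    simp [Fin.sum_univ_succ]
  rw [mem_nul, mem_nul]
  simp_rw [hsucc]
  refine ⟨fun h i => h i.succ, fun h i => ?_⟩
  refine Fin.cases ?_ h i
  have hsum : ∑ k, (δ k : ZMod n) * ∑ j : Fin m, (M k j.succ : ZMod n) * v j = 0 := by
    simp_rw [Finset.mul_sum]
    rw [Finset.sum_comm]
    refine Finset.sum_eq_zero fun j _ => ?_
    have := congrArg (Int.cast : ℤ → ZMod n) (hrow j.succ)
    push_cast at this
    simp_rw [← mul_assoc, ← Finset.sum_mul]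
    simp [this]
  have hrest : ∑ k : Fin m, (δ k.succ : ZMod n) *
      ∑ j : Fin m, (M k.succ j.succ : ZMod n) * v j = 0 :=
    Finset.sum_eq_zero fun k _ => by
      rw [show ∑ j : Fin m, (M k.succ j.succ : ZMod n) * v j = 0 from h k, mul_zero]
  rw [Fin.sum_univ_succ, hrest, add_zero] at hsum
  have hu : IsUnit ((δ 0 : ℤ) : ZMod n) := (δ 0).isUnit.map (Int.castRingHom (ZMod n))
  exact hu.mul_right_eq_zero.mp hsum

theorem bijOn_tail_nul {n m : ℕ} {M : Matrix (Fin (m + 1)) (Fin (m + 1)) ℤ}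
    (δ : Fin (m + 1) → ℤˣ) (hrow : ∀ a, ∑ k, (δ k : ℤ) * M k a = 0) :
    Set.BijOn Fin.tail {v : Fin (m + 1) → ZMod n | v ∈ nul n M ∧ v 0 = 0 ∧ v ≠ 0}
      {v | v ∈ nul n (deleteFirst M) ∧ v ≠ 0} := by
  have hcons : ∀ v : Fin (m + 1) → ZMod n, v 0 = 0 →
      Fin.cons (α := fun _ => ZMod n) 0 (Fin.tail v) = v := fun v hv => by
    rw [← hv]; exact Fin.cons_self_tail v
  have hzero : (Fin.cons (α := fun _ => ZMod n) 0 0 : Fin (m + 1) → ZMod n) = 0 := by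
    ext i; refine Fin.cases ?_ (fun j => ?_) i <;> simp
  refine ⟨?_, ?_, ?_⟩
  · rintro v ⟨hv, hv0, hne⟩
    refine ⟨(cons_zero_mem_nul_iff δ hrow _).mp (by rwa [hcons v hv0]), fun h => hne ?_⟩
    rw [← hcons v hv0, h, hzero]
  · rintro v ⟨-, hv0, -⟩ v' ⟨-, hv0', -⟩ h
    rw [← hcons v hv0, ← hcons v' hv0', h]
  · rintro v ⟨hv, hne⟩
    refine ⟨Fin.cons (α := fun _ => ZMod n) 0 v,
      ⟨(cons_zero_mem_nul_iff δ hrow v).mpr hv, rfl, fun h => hne ?_⟩, Fin.tail_cons _ _⟩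
    rw [← Fin.tail_cons (α := fun _ => ZMod n) 0 v, h]
    rfl

/-- If the determinant `d` divides `n ≠ 0`, then `y ↦ (n / d) * adjugate A * y` induces an
isomorphism from the cokernel of `A` to the null space of `A` modulo `n`. -/
theorem card_nul_eq_natAbs_det {m : ℕ} (A : Matrix (Fin m) (Fin m) ℤ) {n : ℕ}
    (hn : n ≠ 0) (hdvd : A.det ∣ n) : Nat.card (nul n A) = A.det.natAbs := by
  obtain ⟨e, he⟩ := hdvd
  set B : Matrix (Fin m) (Fin m) ℤ := e • A.adjugate with hB
  have hAB : A * B = (n : ℤ) • (1 : Matrix (Fin m) (Fin m) ℤ) := by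
    rw [hB, Matrix.mul_smul, mul_adjugate, smul_smul, mul_comm, he]
  have hBA : B * A = (n : ℤ) • (1 : Matrix (Fin m) (Fin m) ℤ) := by
    rw [hB, smul_mul, adjugate_mul, smul_smul, mul_comm, he]
  have hn' : (n : ℤ) ≠ 0 := by exact_mod_cast hn
  have hinj : Function.Injective A.mulVec := by
    intro x y hxy
    have : (n : ℤ) • x = (n : ℤ) • y := by
      have := congrArg B.mulVec hxy
      simpa [mulVec_mulVec, hBA, smul_mulVec] using this
    exact smul_right_injective _ hn' this
  have hcast : ∀ (M : Matrix (Fin m) (Fin m) ℤ) (y : Fin m → ℤ) (i : Fin m),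
      (((M *ᵥ y) i : ℤ) : ZMod n) = ∑ j, (M i j : ZMod n) * (y j : ZMod n) := fun M y i => by
    simp [mulVec, dotProduct]
  let f : (Fin m → ℤ) →+ nul n A :=
    { toFun := fun y => ⟨fun i => ((B *ᵥ y) i : ZMod n), mem_nul.mpr fun i => by
        rw [← hcast, mulVec_mulVec, hAB]; simp⟩
      map_zero' := by ext i; simp
      map_add' := fun x y => by ext i; simp [mulVec_add] }
  have hsurj : Function.Surjective f := by
    rintro ⟨v, hv⟩
    choose V hV using fun i => ZMod.intCast_surjective (v i)
    have : ∀ i, ∃ y : ℤ, (A *ᵥ V) i = n * y := fun i => by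
      obtain ⟨y, hy⟩ := (ZMod.intCast_zmod_eq_zero_iff_dvd ((A *ᵥ V) i) n).mp
        (by rw [hcast]; simpa [hV] using mem_nul.mp hv i)
      exact ⟨y, hy⟩
    choose y hy using this
    refine ⟨y, Subtype.ext (funext fun i => ?_)⟩
    have hyV : B *ᵥ y = V := by
      apply smul_right_injective _ hn'
      have : (n : ℤ) • y = A *ᵥ V := funext fun i => by simp [hy]
      simp only
      rw [← mulVec_smul, this, mulVec_mulVec, hBA, smul_mulVec, one_mulVec]
    change (((B *ᵥ y) i : ℤ) : ZMod n) = v i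
    rw [hyV, hV]
  have hker : f.ker = (LinearMap.range A.mulVecLin).toAddSubgroup := by
    ext y
    rw [AddMonoidHom.mem_ker, Submodule.mem_toAddSubgroup, LinearMap.mem_range]
    constructor
    · intro hy
      have : ∀ i, ∃ z : ℤ, (B *ᵥ y) i = n * z := fun i => by
        obtain ⟨z, hz⟩ := (ZMod.intCast_zmod_eq_zero_iff_dvd ((B *ᵥ y) i) n).mp
          (congrFun (congrArg Subtype.val hy) i)
        exact ⟨z, hz⟩
      choose z hz using this
      refine ⟨z, smul_right_injective _ hn' ?_⟩
      have : (n : ℤ) • z = B *ᵥ y := funext fun i => by simp [hz]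
      simp only [mulVecLin_apply]
      rw [← mulVec_smul, this, mulVec_mulVec, hAB, smul_mulVec, one_mulVec]
    · rintro ⟨z, rfl⟩
      ext i
      change (((B *ᵥ (A *ᵥ z)) i : ℤ) : ZMod n) = 0
      rw [mulVec_mulVec, hBA]
      simp
  rw [← Nat.card_congr (QuotientAddGroup.quotientKerEquivOfSurjective f hsurj).toEquiv, hker]
  let eq : (Fin m → ℤ) ≃ₗ[ℤ] LinearMap.range A.mulVecLin :=
    LinearEquiv.ofInjective A.mulVecLin hinj
  have := Submodule.natAbs_det_equiv (LinearMap.range A.mulVecLin) eq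
  have hdet : LinearMap.det
      ((LinearMap.range A.mulVecLin).subtype ∘ₗ (eq : _ →ₗ[ℤ] _)) = A.det := by
    have : (LinearMap.range A.mulVecLin).subtype ∘ₗ (eq : _ →ₗ[ℤ] _) = Matrix.toLin' A := by
      ext; rfl
    rw [this, LinearMap.det_toLin']
  rw [← hdet]
  exact this.symm

theorem nul_zero_eq_bot_iff {m : ℕ} (A : Matrix (Fin m) (Fin m) ℤ) :
    nul 0 A = ⊥ ↔ A.det ≠ 0 := by
  rw [Ne, ← Matrix.exists_mulVec_eq_zero_iff, Submodule.eq_bot_iff]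
  push Not
  refine forall_congr' fun v => ?_
  have : v ∈ nul 0 A ↔ A *ᵥ v = 0 := by
    rw [mem_nul, funext_iff]; rfl
  rw [this]
  exact not_imp_not.symm

/-- The null spaces of a square integer matrix modulo all `n`, including `n = 0`, determine the
absolute value of its determinant. -/
theorem abs_det_eq_of_nul_equiv {m t : ℕ} (A : Matrix (Fin m) (Fin m) ℤ)
    (B : Matrix (Fin t) (Fin t) ℤ) (h : ∀ n, Nonempty (nul n A ≃ₗ[ZMod n] nul n B)) :
    |A.det| = |B.det| := by
  have hiff : A.det ≠ 0 ↔ B.det ≠ 0 := by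
    obtain ⟨e⟩ := h 0
    rw [← nul_zero_eq_bot_iff, ← nul_zero_eq_bot_iff, ← Submodule.subsingleton_iff_eq_bot,
      ← Submodule.subsingleton_iff_eq_bot]
    exact e.toEquiv.subsingleton_congr
  by_cases hA : A.det = 0
  · rw [hA, not_not.mp (mt hiff.mpr (not_not.mpr hA))]
  have hB := hiff.mp hA
  obtain ⟨e⟩ := h (A.det * B.det).natAbs
  have hn : (A.det * B.det).natAbs ≠ 0 := Int.natAbs_ne_zero.mpr (mul_ne_zero hA hB)
  rw [Int.abs_eq_natAbs, Int.abs_eq_natAbs,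
    ← card_nul_eq_natAbs_det A hn (Int.dvd_natAbs.mpr (dvd_mul_right _ _)),
    ← card_nul_eq_natAbs_det B hn (Int.dvd_natAbs.mpr (dvd_mul_left _ _)),
    Nat.card_congr e.toEquiv]

end IntegerMatrices

/-! ### Regions, corners and the checkerboard shading -/

theorem zmod_four_cases : ∀ a : ZMod 4, a = 0 ∨ a = 1 ∨ a = 2 ∨ a = 3 := by
  decide

namespace KnotDiagram

open Matrix
open scoped Classical

variable {c : ℕ} (D : KnotDiagram c)

noncomputable instance : Fintype D.Region := Fintype.ofFinite _

instance : Finite D.Strand := inferInstanceAs (Finite (Quotient D.strandSetoid))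

noncomputable instance : Fintype D.Strand := Fintype.ofFinite _

theorem sum_zmod_four {M : Type*} [AddCommMonoid M] (f : ZMod 4 → M) :
    ∑ a, f a = f 0 + f 1 + f 2 + f 3 :=
  Fin.sum_univ_four f

theorem region_facePerm (d : Dart c) : D.region (facePerm D.edge d) = D.region d :=
  Quotient.sound (s := Equiv.Perm.SameCycle.setoid (facePerm D.edge)) ⟨-1, by simp⟩

theorem region_edge (k : Fin c) (a : ZMod 4) :
    D.region (D.edge (k, a)) = D.region (k, a - 1) := by
  rw [← D.region_facePerm (D.edge (k, a))]
  congr 1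
  simp only [facePerm, Equiv.Perm.mul_apply, D.edge_edge, Equiv.Perm.inv_eq_iff_eq]
  simp [Dart.rotate]

theorem region_edge_facePerm_symm (k : Fin c) (a : ZMod 4) :
    D.region (D.edge ((facePerm D.edge)⁻¹ (k, a))) = D.region (k, a + 1) := by
  congr 1
  simp [facePerm, Dart.rotate]

/-- A diagram of a knot is connected: a property of arms that is passed along edges and straight
through crossings holds everywhere or nowhere. -/
theorem knot_induction {P : Dart c → Prop} (hedge : ∀ d, P d ↔ P (D.edge d))
    (hopp : ∀ d : Dart c, P d ↔ P d.opp) (d e : Dart c) : P d → P e := by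
  have : P d ↔ P e := by
    induction D.knot d e with
    | rel x y h =>
      rcases h with rfl | rfl
      · exact hedge x
      · exact hopp x
    | refl x => rfl
    | symm x y _ ih => exact ih.symm
    | trans x y z _ _ ih₁ ih₂ => exact ih₁.trans ih₂
  exact this.mp

theorem strand_edge (d : Dart c) : D.strand (D.edge d) = D.strand d :=
  (Quotient.sound (s := D.strandSetoid) (Relation.EqvGen.rel _ _ (Or.inl rfl))).symm

theorem strand_three (k : Fin c) : D.strand (k, 3) = D.strand (k, 1) :=
  (Quotient.sound (s := D.strandSetoid)
    (Relation.EqvGen.rel (k, 1) (k, 3) (Or.inr ⟨rfl, rfl⟩))).symm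

theorem strand_lift_eq {X : Type*} {x : Dart c → X} (hedge : ∀ d, x (D.edge d) = x d)
    (hover : ∀ k, x (k, 3) = x (k, 1)) {d e : Dart c} (h : D.strand d = D.strand e) :
    x d = x e := by
  have h' : Relation.EqvGen (fun a b => b = D.edge a ∨ (a.2 = 1 ∧ b = Dart.opp a)) d e :=
    Quotient.exact h
  clear h
  induction h' with
  | rel x y h =>
    rcases h with rfl | ⟨h1, rfl⟩
    · exact (hedge _).symm
    · obtain ⟨k, a⟩ := x
      obtain rfl : a = 1 := h1
      exact (hover k).symm
  | refl x => rfl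
  | symm x y _ ih => exact ih.symm
  | trans x y z _ _ ih₁ ih₂ => exact ih₁.trans ih₂

namespace Checkerboard

variable {D} (S : D.Checkerboard)

/-- The opposite checkerboard coloring. -/
def compl : D.Checkerboard where
  shaded R := ¬ S.shaded R
  alternate d := not_congr (S.alternate d)

theorem shaded_edge (d : Dart c) : S.shaded (D.region (D.edge d)) ↔ ¬ S.shaded (D.region d) := by
  have := S.alternate d
  tauto

theorem shaded_sub_one (k : Fin c) (a : ZMod 4) :
    S.shaded (D.region (k, a - 1)) ↔ ¬ S.shaded (D.region (k, a)) := by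
  rw [← D.region_edge, S.shaded_edge]

theorem shaded_add_one (k : Fin c) (a : ZMod 4) :
    S.shaded (D.region (k, a + 1)) ↔ ¬ S.shaded (D.region (k, a)) := by
  have := S.shaded_sub_one k (a + 1)
  rw [add_sub_cancel_right] at this
  tauto

theorem shaded_add_two (k : Fin c) (a : ZMod 4) :
    S.shaded (D.region (k, a + 2)) ↔ S.shaded (D.region (k, a)) := by
  rw [show a + 2 = a + 1 + 1 by ring, S.shaded_add_one, S.shaded_add_one, not_not]

/-- The shaded regions are connected through the crossings. -/
theorem shaded_induction {P : D.Region → Prop}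
    (hP : ∀ k a, S.shaded (D.region (k, a)) → (P (D.region (k, a)) ↔ P (D.region (k, a + 2))))
    {R R' : D.Region} (hR : S.shaded R) (hR' : S.shaded R') : P R → P R' := by
  obtain ⟨d, rfl⟩ := Quotient.exists_rep R
  obtain ⟨d', rfl⟩ := Quotient.exists_rep R'
  change S.shaded (D.region d) at hR
  change S.shaded (D.region d') at hR'
  change P (D.region d) → P (D.region d')
  -- the arm `d` carries the truth value of `P` at the shaded region beside `d`
  have key := D.knot_induction
    (P := fun d => (S.shaded (D.region d) ∧ P (D.region d)) ∨
      (¬ S.shaded (D.region d) ∧ P (D.region (D.edge d)))) (fun d => ?_) (fun d => ?_) d d'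
  · tauto
  · have := S.shaded_edge d
    rw [D.edge_edge]
    tauto
  · obtain ⟨k, a⟩ := d
    have h1 := S.shaded_add_two k a
    have h2 := hP k a
    have h3 := hP k (a - 1)
    have h4 := S.shaded_sub_one k a
    rw [show a - 1 + 2 = a + 2 - 1 by ring] at h3
    simp only [Dart.opp, D.region_edge]
    tauto

/-- The two arms of an edge have opposite shading on their left, hence a function of the edges
has vanishing sum with signs according to this shading. -/
theorem sum_shade_eq_zero {R : Type*} [AddCommGroup R] {x : Dart c → R}
    (hx : ∀ d, x (D.edge d) = x d) :
    ∑ d, (if S.shaded (D.region d) then x d else - x d) = 0 := by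
  refine Finset.sum_involution (fun d _ => D.edge d) (fun d _ => ?_) (fun d _ _ => D.edge_ne d)
    (fun d _ => Finset.mem_univ _) (fun d _ => D.edge_edge d)
  have := S.shaded_edge d
  by_cases h : S.shaded (D.region d) <;> simp [this, h, hx]

/-- The sign of a crossing as a unit. -/
noncomputable def signUnit (k : Fin c) : ℤˣ := if S.shaded (D.region (k, 1)) then -1 else 1

theorem coe_signUnit (k : Fin c) : (S.signUnit k : ℤ) = S.sign k := by
  unfold signUnit sign
  split_ifs <;> rfl

/-- The left sides of the coloring equations, multiplied by the signs of the crossings, have sum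
zero: this is `sum_shade_eq_zero` with its terms grouped by the crossings. -/
theorem sum_sign_mul_eq_zero {R : Type*} [CommRing R] {x : Dart c → R}
    (hx : ∀ d, x (D.edge d) = x d) (hover : ∀ k, x (k, 3) = x (k, 1)) :
    ∑ k, (S.sign k : R) * (x (k, 0) + x (k, 2) - 2 * x (k, 1)) = 0 := by
  rw [← S.sum_shade_eq_zero hx, Fintype.sum_prod_type]
  refine Finset.sum_congr rfl fun k _ => ?_
  have h1 := S.shaded_add_one k 0
  have h2 := S.shaded_add_two k 0
  have h3 := S.shaded_add_two k 1
  rw [zero_add] at h1 h2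
  rw [show (1 : ZMod 4) + 2 = 3 from rfl] at h3
  rw [sum_zmod_four, sign]
  by_cases h : S.shaded (D.region (k, 0)) <;> simp [h1, h2, h3, h, hover] <;> ring

end Checkerboard

/-! ### The number of strands -/

/-- A strand has an even number of understrand arms: its edges match all its arms in pairs, and its
overpasses match its overstrand arms in pairs. -/
theorem even_card_under (s : D.Strand) :
    Even (Finset.univ.filter fun q : Fin c × Bool =>
      D.strand (q.1, if q.2 then 2 else 0) = s).card := by
  have hall : ∑ d : Dart c, (if D.strand d = s then 1 else 0 : ZMod 2) = 0 := by
    refine Finset.sum_involution (fun d _ => D.edge d) (fun d _ => ?_) (fun d _ _ => D.edge_ne d)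
      (fun d _ => Finset.mem_univ _) (fun d _ => D.edge_edge d)
    rw [D.strand_edge, CharTwo.add_self_eq_zero]
  rw [Fintype.sum_prod_type] at hall
  rw [← ZMod.natCast_eq_zero_iff_even, Finset.card_filter]
  push_cast
  rw [Fintype.sum_prod_type]
  refine Eq.trans ?_ hall
  refine Finset.sum_congr rfl fun k _ => ?_
  rw [sum_zmod_four, D.strand_three, Fintype.sum_bool]
  have := CharTwo.add_self_eq_zero (if D.strand (k, 1) = s then 1 else 0 : ZMod 2)
  simp only [if_true, Bool.false_eq_true, if_false]
  linear_combination -this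

theorem exists_under (s : D.Strand) :
    ∃ q : Fin c × Bool, D.strand (q.1, if q.2 then 2 else 0) = s := by
  by_contra! hs
  have h0 : ∀ k, D.strand (k, 0) ≠ s := fun k => hs (k, false)
  have h2 : ∀ k, D.strand (k, 2) ≠ s := fun k => hs (k, true)
  obtain ⟨d, rfl⟩ := Quotient.exists_rep s
  refine h0 d.1 (D.knot_induction (P := fun e => D.strand e = D.strand d) (fun e => ?_)
    (fun e => ?_) d (d.1, 0) rfl)
  · rw [D.strand_edge]
  · obtain ⟨k, a⟩ := e
    have h0' : D.strand (k, 0) ≠ D.strand d := h0 k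
    have h2' : D.strand (k, 2) ≠ D.strand d := h2 k
    have h3 := D.strand_three k
    fin_cases a
    · exact iff_of_false h0' h2'
    · change D.strand (k, 1) = _ ↔ D.strand (k, 3) = _
      rw [h3]
    · exact iff_of_false h2' h0'
    · change D.strand (k, 3) = _ ↔ D.strand (k, 1) = _
      rw [h3]

theorem card_strand_le : Fintype.card D.Strand ≤ c := by
  have h := Finset.card_eq_sum_card_fiberwise (s := (Finset.univ : Finset (Fin c × Bool)))
    (t := (Finset.univ : Finset D.Strand))
    (f := fun q => D.strand (q.1, if q.2 then 2 else 0))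
    (fun _ _ => Finset.mem_coe.mpr (Finset.mem_univ _))
  have h2 := Finset.card_nsmul_le_sum (Finset.univ : Finset D.Strand)
    (fun s => (Finset.univ.filter fun q : Fin c × Bool =>
      D.strand (q.1, if q.2 then 2 else 0) = s).card) 2 (fun s _ => by
        obtain ⟨q, hq⟩ := D.exists_under s
        have hpos : (Finset.univ.filter fun q : Fin c × Bool =>
          D.strand (q.1, if q.2 then 2 else 0) = s).Nonempty := ⟨q, by simpa using hq⟩
        rw [← Finset.card_pos] at hpos
        obtain ⟨r, hr⟩ := D.even_card_under s
        omega)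
  rw [← h] at h2
  simp at h2
  omega

namespace Checkerboard

variable {D} (S : D.Checkerboard)

theorem card_shaded_darts : Fintype.card {d // S.shaded (D.region d)} = 2 * c := by
  have h1 := Fintype.card_subtype_compl (fun d => S.shaded (D.region d))
  have h2 := Fintype.card_subtype_le (fun d => S.shaded (D.region d))
  have h3 : Fintype.card {d // S.shaded (D.region d)} =
      Fintype.card {d // ¬ S.shaded (D.region d)} :=
    Fintype.card_congr (D.edge.subtypeEquiv S.alternate)
  have h4 : Fintype.card (Dart c) = c * 4 := by simp [ZMod.card]
  omega

/-- The strands arise from `4 * c` arms by `3 * c` identifications: one for each edge, represented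
by the arm with a shaded left side, and one for each overpass. -/
theorem le_card_strand {D : KnotDiagram c} (S : D.Checkerboard) : c ≤ Fintype.card D.Strand := by
  let T : (Dart c → ℚ) →ₗ[ℚ] ({d // S.shaded (D.region d)} ⊕ Fin c → ℚ) :=
    { toFun := fun f => Sum.elim (fun d => f d.1 - f (D.edge d.1)) fun k => f (k, 1) - f (k, 3)
      map_add' := fun f g => by ext (d | k) <;> simp <;> ring
      map_smul' := fun r f => by ext (d | k) <;> simp <;> ring }
  have hT := LinearMap.finrank_range_add_finrank_ker T
  have hr : Module.finrank ℚ (LinearMap.range T) ≤ 2 * c + c := by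
    refine (Submodule.finrank_le _).trans ?_
    rw [Module.finrank_fintype_fun_eq_card, Fintype.card_sum, S.card_shaded_darts, Fintype.card_fin]
  rw [Module.finrank_fintype_fun_eq_card] at hT
  have h4 : Fintype.card (Dart c) = c * 4 := by simp [ZMod.card]
  have hle : LinearMap.ker T ≤ LinearMap.range (LinearMap.funLeft ℚ ℚ D.strand) := by
    intro f hf
    have hf' := congrFun (LinearMap.mem_ker.mp hf)
    refine ⟨fun s => f s.out, funext fun d => ?_⟩
    refine D.strand_lift_eq (x := f) (fun e => ?_) (fun k => ?_) (Quotient.out_eq (D.strand d))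
    · by_cases he : S.shaded (D.region e)
      · have := hf' (Sum.inl ⟨e, he⟩)
        exact (sub_eq_zero.mp this).symm
      · have := hf' (Sum.inl ⟨D.edge e, (S.shaded_edge e).mpr he⟩)
        have := sub_eq_zero.mp this
        simpa [D.edge_edge] using this
    · exact (sub_eq_zero.mp (hf' (Sum.inr k))).symm
  have h5 := (Submodule.finrank_mono hle).trans
    (LinearMap.finrank_range_le (LinearMap.funLeft ℚ ℚ D.strand))
  rw [Module.finrank_fintype_fun_eq_card] at h5
  omega

theorem card_strand {D : KnotDiagram c} (S : D.Checkerboard) : Nat.card D.Strand = c := by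
  rw [Nat.card_eq_fintype_card]
  exact le_antisymm D.card_strand_le S.le_card_strand

end Checkerboard

end KnotDiagram

namespace KnotDiagram

open Matrix
open scoped Classical

namespace Checkerboard

variable {c : ℕ} {D : KnotDiagram c} (S : D.Checkerboard)

/-! ### The diagram and its dual: strand colorings come from region values -/

/-- The divergence of the knot projection, whose edges are oriented so that the left side is
shaded. -/
theorem projection_divergence {R : Type*} [CommRing R] {w : Dart c → R}
    (hw : ∀ d, w (D.edge d) = - w d) (k : Fin c) :
    ((incidence R (fun e : {d // S.shaded (D.region d)} => e.1.1) (fun e => (D.edge e.1).1))ᵀ *ᵥ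
      fun e => w e.1) k = ∑ a, w (k, a) := by
  rw [incidence_transpose_mulVec]
  let F : Dart c → R := fun d => if d.1 = k then w d else 0
  have h1 : ∑ d, F d = ∑ a, w (k, a) := by
    rw [Fintype.sum_prod_type, Finset.sum_eq_single k] <;> simp +contextual [F]
  have h2 : ∑ d, F d = ∑ d, (if S.shaded (D.region d) then F d + F (D.edge d) else 0) := by
    have h3 : ∑ d, F d = ∑ d, (if S.shaded (D.region d) then F d else 0) +
        ∑ d, (if S.shaded (D.region d) then 0 else F d) := by
      rw [← Finset.sum_add_distrib]
      exact Finset.sum_congr rfl fun d _ => by split_ifs <;> simp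
    rw [h3, ← Equiv.sum_comp D.edge (fun d => if S.shaded (D.region d) then 0 else F d),
      ← Finset.sum_add_distrib]
    refine Finset.sum_congr rfl fun d _ => ?_
    have := S.shaded_edge d
    by_cases h : S.shaded (D.region d) <;> simp [this, h]
  rw [← h1, h2, ← Finset.sum_filter, ← Finset.sum_subtype_eq_sum_filter]
  rw [Finset.subtype_univ]
  refine Finset.sum_congr rfl fun e _ => ?_
  simp only [F, hw]
  split_ifs <;> ring

theorem projection_connected :
    GraphConnected (fun e : {d // S.shaded (D.region d)} => e.1.1) (fun e => (D.edge e.1).1) := by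
  intro P hP k k' hk
  refine D.knot_induction (P := fun d => P d.1) (fun d => ?_) (fun d => Iff.rfl) (k, 0) (k', 0) hk
  by_cases h : S.shaded (D.region d)
  · exact hP ⟨d, h⟩
  · have := hP ⟨D.edge d, (S.shaded_edge d).mpr h⟩
    simp only [D.edge_edge] at this
    exact this.symm

theorem dual_connected :
    GraphConnected (fun e : {d // S.shaded (D.region d)} => D.region e.1)
      (fun e => D.region (D.edge e.1)) := by
  intro P hP R R' hR
  obtain ⟨d, rfl⟩ := Quotient.exists_rep R
  obtain ⟨d', rfl⟩ := Quotient.exists_rep R'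
  have hedge : ∀ d, P (D.region d) ↔ P (D.region (D.edge d)) := fun d => by
    by_cases h : S.shaded (D.region d)
    · exact hP ⟨d, h⟩
    · have := hP ⟨D.edge d, (S.shaded_edge d).mpr h⟩
      simp only [D.edge_edge] at this
      exact this.symm
  refine D.knot_induction (P := fun d => P (D.region d)) hedge (fun d => ?_) d d' hR
  obtain ⟨k, a⟩ := d
  have h1 := hedge (k, a + 2)
  have h2 := hedge (k, a + 1)
  rw [D.region_edge] at h1 h2
  rw [show a + 2 - 1 = a + 1 by ring] at h1
  rw [add_sub_cancel_right] at h2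
  exact (h1.trans h2).symm

theorem _root_.KnotDiagram.card_region (D : KnotDiagram c) : Fintype.card D.Region = c + 2 := by
  have := D.planar
  rw [Nat.card_eq_fintype_card] at this
  have h : Fintype.card D.Region = Fintype.card (Face D.edge) := Fintype.card_congr (Equiv.refl _)
  omega

/-- A strand coloring that solves the coloring equations is the sum of the values of a function of
the regions on the two sides. Here the shaded regions enter with a positive and the unshaded ones
with a negative sign, so that the coloring becomes a divergence-free vector on the projection,
and the claim is that it is the coboundary of a function on the sphere. -/
theorem exists_region_values {D : KnotDiagram c} (S : D.Checkerboard) {n : ℕ}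
    {x : Dart c → ZMod n} (hx : ∀ d, x (D.edge d) = x d) (hover : ∀ k, x (k, 3) = x (k, 1))
    (heq : ∀ k, x (k, 0) + x (k, 2) - 2 * x (k, 1) = 0) :
    ∃ h : D.Region → ZMod n, ∀ d, h (D.region d) + h (D.region (D.edge d)) = x d := by
  obtain ⟨h, hh⟩ := exists_incidence_mulVec_eq S.dual_connected S.projection_connected
    (by rw [S.card_shaded_darts, D.card_region, Fintype.card_fin]; omega)
    (by
      apply mulVec_injective
      ext g k
      rw [← mulVec_mulVec, zero_mulVec]
      have h1 : (incidence ℤ (fun e : {d // S.shaded (D.region d)} => D.region e.1)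
          (fun e => D.region (D.edge e.1))) *ᵥ g =
          fun e => g (D.region e.1) - g (D.region (D.edge e.1)) := by
        ext e; rw [incidence_mulVec]
      rw [h1, S.projection_divergence (w := fun d => g (D.region d) - g (D.region (D.edge d)))
        (fun d => by rw [D.edge_edge]; ring)]
      simp_rw [D.region_edge]
      rw [Finset.sum_sub_distrib, Pi.zero_apply, sub_eq_zero]
      exact (Equiv.sum_comp (Equiv.subRight (1 : ZMod 4)) (fun a => g (D.region (k, a)))).symm)
    (fun e => x e.1)
    (by
      ext k
      have h0 : (fun e : {d // S.shaded (D.region d)} => x e.1) =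
          fun e => (fun d => if S.shaded (D.region d) then x d else - x d) e.1 := by
        ext e
        simp [e.2]
      rw [h0, S.projection_divergence (w := fun d => if S.shaded (D.region d) then x d else - x d)]
      · have h1 := S.shaded_add_one k 0
        have h2 := S.shaded_add_two k 0
        have h3 := S.shaded_add_two k 1
        rw [zero_add] at h1 h2
        rw [show (1 : ZMod 4) + 2 = 3 from rfl] at h3
        have := heq k
        rw [sum_zmod_four]
        by_cases h : S.shaded (D.region (k, 0)) <;> simp [h1, h2, h3, h, hover]
        · linear_combination this
        · linear_combination -this
      · intro d
        have := S.shaded_edge d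
        by_cases h : S.shaded (D.region d) <;> simp [this, h, hx])
  have hh' : ∀ d, S.shaded (D.region d) → h (D.region d) - h (D.region (D.edge d)) = x d :=
    fun d hd => by
      have := congrFun hh ⟨d, hd⟩
      rwa [incidence_mulVec] at this
  refine ⟨fun R => if S.shaded R then h R else - h R, fun d => ?_⟩
  have hs := S.shaded_edge d
  by_cases hd : S.shaded (D.region d)
  · have := hh' d hd
    simp only [hs, hd, not_true_eq_false, if_true, if_false]
    linear_combination this
  · have := hh' (D.edge d) (hs.mpr hd)
    rw [D.edge_edge, hx] at this
    simp only [hs, hd, not_false_eq_true, if_true, if_false]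
    linear_combination this

/-! ### The two checkerboard graphs -/

/-- A shaded corner of a crossing; the opposite corner is the other one. The choice falls on the
corner between the arms `3` and `0`, if this is shaded, and on the corner between the arms `0` and
`1` otherwise, which makes the sign in `dehn_equation_iff` equal to the sign of the crossing. -/
noncomputable def corner (k : Fin c) : ZMod 4 := if S.shaded (D.region (k, 1)) then 3 else 0

theorem shaded_corner (k : Fin c) : S.shaded (D.region (k, S.corner k)) := by
  have h1 := S.shaded_add_one k 0
  have h3 := S.shaded_add_two k 1
  rw [zero_add] at h1
  rw [show (1 : ZMod 4) + 2 = 3 from rfl] at h3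
  unfold corner
  split_ifs with h
  · exact h3.mpr h
  · exact not_not.mp (mt h1.mpr h)

theorem eq_corner_or_of_shaded {k : Fin c} {a : ZMod 4} (ha : S.shaded (D.region (k, a))) :
    a = S.corner k ∨ a = S.corner k + 2 := by
  have h := S.shaded_corner k
  have h1 := S.shaded_add_one k (S.corner k)
  have h3 := S.shaded_add_two k (S.corner k + 1)
  rw [add_assoc, show (1 : ZMod 4) + 2 = 3 from rfl] at h3
  obtain ⟨b, rfl⟩ : ∃ b, a = S.corner k + b := ⟨a - S.corner k, by ring⟩
  rcases zmod_four_cases b with rfl | rfl | rfl | rfl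
  · exact Or.inl (add_zero _)
  · exact absurd h (h1.mp ha)
  · exact Or.inr rfl
  · exact absurd h (h1.mp (h3.mp ha))

/-- The edge of the shaded checkerboard graph through the crossing `k` runs from `shadedTail k` to
`shadedHead k`. -/
noncomputable def shadedHead (k : Fin c) : {R : D.Region // S.shaded R} :=
  ⟨D.region (k, S.corner k), S.shaded_corner k⟩

/-- The other end of the edge through `k` in the shaded checkerboard graph. -/
noncomputable def shadedTail (k : Fin c) : {R : D.Region // S.shaded R} :=
  ⟨D.region (k, S.corner k + 2), (S.shaded_add_two k _).mpr (S.shaded_corner k)⟩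

/-- The edge of the unshaded checkerboard graph through the crossing `k` runs from `unshadedTail k`
to `unshadedHead k`; it crosses the edge of the shaded graph from left to right. -/
noncomputable def unshadedHead (k : Fin c) : {R : D.Region // ¬ S.shaded R} :=
  ⟨D.region (k, S.corner k - 1), fun h => (S.shaded_sub_one k _).mp h (S.shaded_corner k)⟩

/-- The other end of the edge through `k` in the unshaded checkerboard graph. -/
noncomputable def unshadedTail (k : Fin c) : {R : D.Region // ¬ S.shaded R} :=
  ⟨D.region (k, S.corner k + 1), fun h => (S.shaded_add_one k _).mp h (S.shaded_corner k)⟩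

theorem shaded_connected : GraphConnected S.shadedHead S.shadedTail := by
  rintro P hP ⟨R, hR⟩ ⟨R', hR'⟩ h
  obtain ⟨_, h'⟩ := S.shaded_induction (P := fun R => ∃ hR, P ⟨R, hR⟩) (fun k a ha => by
    have hk := hP k
    rcases S.eq_corner_or_of_shaded ha with rfl | rfl
    · exact ⟨fun ⟨_, h⟩ => ⟨_, hk.mp h⟩, fun ⟨_, h⟩ => ⟨_, hk.mpr h⟩⟩
    · rw [add_assoc, show (2 : ZMod 4) + 2 = 0 from rfl, add_zero]
      exact ⟨fun ⟨_, h⟩ => ⟨_, hk.mpr h⟩, fun ⟨_, h⟩ => ⟨_, hk.mp h⟩⟩) hR hR' ⟨hR, h⟩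
  exact h'

theorem unshaded_connected : GraphConnected S.unshadedHead S.unshadedTail := by
  rintro P hP ⟨R, hR⟩ ⟨R', hR'⟩ h
  obtain ⟨_, h'⟩ := S.compl.shaded_induction (P := fun R => ∃ hR, P ⟨R, hR⟩) (fun k a ha => by
    have hk := hP k
    have ha' : S.shaded (D.region (k, a - 1)) := (S.shaded_sub_one k a).mpr ha
    rcases S.eq_corner_or_of_shaded ha' with h | h
    · obtain rfl : a = S.corner k + 1 := by rw [← h]; ring
      rw [show S.corner k + 1 + 2 = S.corner k - 1 + 4 by ring, show (4 : ZMod 4) = 0 from rfl,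
        add_zero]
      exact ⟨fun ⟨_, h⟩ => ⟨_, hk.mpr h⟩, fun ⟨_, h⟩ => ⟨_, hk.mp h⟩⟩
    · obtain rfl : a = S.corner k - 1 := by
        rw [show S.corner k - 1 = S.corner k + 2 + 1 - 4 by ring, show (4 : ZMod 4) = 0 from rfl,
          ← h]
        ring
      rw [show S.corner k - 1 + 2 = S.corner k + 1 by ring]
      exact ⟨fun ⟨_, h⟩ => ⟨_, hk.mp h⟩, fun ⟨_, h⟩ => ⟨_, hk.mpr h⟩⟩) hR hR' ⟨hR, h⟩
  exact h'

/-- The corners of a shaded region are listed by the crossings, in each of which it may occupy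
one or both of the shaded corners. -/
theorem sum_corners_eq {R : Type*} [AddCommGroup R] (f : Dart c → R)
    (r : {R : D.Region // S.shaded R}) :
    ∑ d, (if D.region d = r then f d else 0) =
      ∑ k, ((if S.shadedHead k = r then f (k, S.corner k) else 0) +
        (if S.shadedTail k = r then f (k, S.corner k + 2) else 0)) := by
  rw [Fintype.sum_prod_type]
  refine Finset.sum_congr rfl fun k _ => ?_
  have hodd : ∀ a, ¬ S.shaded (D.region (k, a)) → D.region (k, a) ≠ r := fun a ha h =>
    ha (h ▸ r.2)
  have h1 := hodd _ (S.unshadedTail k).2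
  have h3 := hodd (S.corner k + 3) (by
    rw [show S.corner k + 3 = S.corner k - 1 + 4 by ring, show (4 : ZMod 4) = 0 from rfl, add_zero]
    exact (S.unshadedHead k).2)
  rw [← Equiv.sum_comp (Equiv.addLeft (S.corner k)), sum_zmod_four]
  simp [h1, h3, shadedHead, shadedTail, Subtype.ext_iff]
  congr

/-- Walking around a region, the values on the neighboring regions change at each corner, and these
changes have sum zero. -/
theorem _root_.KnotDiagram.sum_around_region_eq_zero {R : Type*} [AddCommGroup R]
    (D : KnotDiagram c) (h : D.Region → R) (r : D.Region) :
    ∑ d : Dart c, (if D.region d = r then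
      h (D.region (d.1, d.2 - 1)) - h (D.region (d.1, d.2 + 1)) else 0) = 0 := by
  have h1 : ∀ d : Dart c, (if D.region d = r then
      h (D.region (d.1, d.2 - 1)) - h (D.region (d.1, d.2 + 1)) else 0) =
      (if D.region d = r then h (D.region (D.edge d)) else 0) -
        (if D.region ((facePerm D.edge)⁻¹ d) = r then
          h (D.region (D.edge ((facePerm D.edge)⁻¹ d))) else 0) := by
    rintro ⟨k, a⟩
    have h2 := D.region_facePerm ((facePerm D.edge)⁻¹ (k, a))
    rw [show facePerm D.edge ((facePerm D.edge)⁻¹ (k, a)) = (k, a) from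
      Equiv.apply_symm_apply (facePerm D.edge) _] at h2
    rw [← h2, D.region_edge, D.region_edge_facePerm_symm]
    split_ifs <;> simp
  simp_rw [h1]
  rw [Finset.sum_sub_distrib, sub_eq_zero]
  exact (Equiv.sum_comp (facePerm D.edge)⁻¹
    (fun d => if D.region d = r then h (D.region (D.edge d)) else 0)).symm

theorem shaded_divergence_unshaded_coboundary (R : Type*) [CommRing R] :
    (incidence R S.shadedHead S.shadedTail)ᵀ * incidence R S.unshadedHead S.unshadedTail = 0 := by
  apply mulVec_injective
  ext g r
  rw [← mulVec_mulVec, zero_mulVec, incidence_transpose_mulVec, Pi.zero_apply]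
  let h : D.Region → R := fun Q => if hQ : S.shaded Q then 0 else g ⟨Q, hQ⟩
  have hh : ∀ Q : {Q // ¬ S.shaded Q}, g Q = h Q := fun Q => by simp [h, Q.2]
  refine Eq.trans ?_ (D.sum_around_region_eq_zero h r)
  rw [S.sum_corners_eq]
  refine Finset.sum_congr rfl fun k _ => ?_
  rw [incidence_mulVec, hh, hh]
  have h4 : S.corner k + 2 + 1 = S.corner k - 1 := by
    rw [show S.corner k - 1 = S.corner k + 2 + 1 - 4 by ring, show (4 : ZMod 4) = 0 from rfl,
      sub_zero]
  simp only [h4, show S.corner k + 2 - 1 = S.corner k + 1 by ring, unshadedHead, unshadedTail]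
  split_ifs <;> ring

theorem card_checkerboard : Fintype.card (Fin c) + 2 =
    Fintype.card {R // ¬ S.shaded R} + Fintype.card {R // S.shaded R} := by
  have h1 := Fintype.card_subtype_compl S.shaded
  have h2 := Fintype.card_subtype_le S.shaded
  rw [D.card_region] at h1 h2
  rw [Fintype.card_fin]
  omega

/-- The equation of a crossing for region values, written with differences of opposite corners. -/
theorem dehn_equation_iff {R : Type*} [CommRing R] (h : D.Region → R) (k : Fin c) :
    h (D.region (k, 0)) + h (D.region (k, 1)) = h (D.region (k, 2)) + h (D.region (k, 3)) ↔
      (S.sign k : R) * (h (S.shadedHead k) - h (S.shadedTail k)) =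
        h (S.unshadedHead k) - h (S.unshadedTail k) := by
  change _ ↔ (S.sign k : R) * (h (D.region (k, S.corner k)) - h (D.region (k, S.corner k + 2))) =
    h (D.region (k, S.corner k - 1)) - h (D.region (k, S.corner k + 1))
  by_cases hs : S.shaded (D.region (k, 1))
  · rw [show S.corner k = 3 from if_pos hs, show S.sign k = -1 from if_pos hs,
      show (3 : ZMod 4) + 2 = 1 from rfl, show (3 : ZMod 4) + 1 = 0 from rfl,
      show (3 : ZMod 4) - 1 = 2 from rfl]
    push_cast
    constructor <;> intro e <;> linear_combination e
  · rw [show S.corner k = 0 from if_neg hs, show S.sign k = 1 from if_neg hs,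
      show (0 : ZMod 4) + 2 = 2 from rfl, show (0 : ZMod 4) + 1 = 1 from rfl,
      show (0 : ZMod 4) - 1 = 3 from rfl]
    push_cast
    constructor <;> intro e <;> linear_combination e

/-- The Goeritz matrix is, up to sign, the Laplacian of the shaded checkerboard graph, with the
signs of the crossings as weights of the edges. -/
theorem preGoeritzMatrix_mulVec {R : Type*} [CommRing R] {s : ℕ}
    (ρ : Fin s ≃ {R : D.Region // S.shaded R}) (h : {R : D.Region // S.shaded R} → R) (i : Fin s) :
    ∑ j, (S.preGoeritzMatrix ρ i j : R) * h (ρ j) =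
      - ((incidence R S.shadedHead S.shadedTail)ᵀ *ᵥ
        fun k => (S.sign k : R) * (h (S.shadedHead k) - h (S.shadedTail k))) (ρ i) := by
  have hlap : ∑ j, (S.preGoeritzMatrix ρ i j : R) * h (ρ j) =
      ∑ j, (S.goeritzEntry (ρ i).1 (ρ j).1 : R) * (h (ρ j) - h (ρ i)) := by
    rw [← Finset.add_sum_erase _ _ (Finset.mem_univ i),
      ← Finset.add_sum_erase (a := i) _ (fun j =>
        (S.goeritzEntry (ρ i).1 (ρ j).1 : R) * (h (ρ j) - h (ρ i))) (Finset.mem_univ i)]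
    simp only [preGoeritzMatrix, Matrix.of_apply, if_true, sub_self, mul_zero, zero_add, mul_sub,
      Finset.sum_sub_distrib]
    push_cast
    rw [neg_mul, Finset.sum_mul, neg_add_eq_sub]
    congr 1
    refine Finset.sum_congr rfl fun j hj => ?_
    rw [if_neg (Finset.ne_of_mem_erase hj).symm]
  rw [hlap, Equiv.sum_comp ρ (fun r => (S.goeritzEntry (ρ i).1 r.1 : R) * (h r - h (ρ i))),
    incidence_transpose_mulVec, ← Finset.sum_neg_distrib]
  simp_rw [goeritzEntry, Int.cast_sum, Finset.sum_mul]
  rw [Finset.sum_comm]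
  refine Finset.sum_congr rfl fun k _ => ?_
  generalize ρ i = r
  have hmeet : ∀ r' : {R // S.shaded R}, D.MeetAt k r r' ↔
      (S.shadedHead k = r ∧ S.shadedTail k = r') ∨ (S.shadedTail k = r ∧ S.shadedHead k = r') := by
    intro r'
    simp only [Subtype.ext_iff]
    constructor
    · rintro ⟨a, ha, ha'⟩
      rcases S.eq_corner_or_of_shaded (ha ▸ r.2) with rfl | rfl
      · exact Or.inl ⟨ha, ha'⟩
      · rw [add_assoc, show (2 : ZMod 4) + 2 = 0 from rfl, add_zero] at ha'
        exact Or.inr ⟨ha, ha'⟩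
    · rintro (⟨h1, h2⟩ | ⟨h1, h2⟩)
      · exact ⟨_, h1, h2⟩
      · refine ⟨_, h1, ?_⟩
        rw [add_assoc, show (2 : ZMod 4) + 2 = 0 from rfl, add_zero]
        exact h2
  set A := S.shadedHead k
  set B := S.shadedTail k
  have hterm : ∀ r' : {R // S.shaded R},
      (((if D.MeetAt k r r' then S.sign k else 0 : ℤ)) : R) * (h r' - h r) =
        (if B = r' then (if A = r then (S.sign k : R) * (h B - h A) else 0) else 0) +
        (if A = r' then (if B = r then (S.sign k : R) * (h A - h B) else 0) else 0) := by
    intro r'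
    rw [hmeet]
    by_cases hA : A = r <;> by_cases hB : B = r <;> by_cases hA' : A = r' <;>
      by_cases hB' : B = r' <;> simp_all
  simp_rw [hterm]
  rw [Finset.sum_add_distrib, Finset.sum_ite_eq, Finset.sum_ite_eq]
  simp only [Finset.mem_univ, if_true]
  split_ifs <;> ring

/-- Values on the shaded regions that solve the Goeritz equations extend to a solution of the
crossing equations: the weighted differences form a divergence-free vector on the shaded
checkerboard graph, so they are the differences of a function of the unshaded regions. -/
theorem exists_unshaded_values {n : ℕ} {u : {R // S.shaded R} → ZMod n}
    (hu : (incidence (ZMod n) S.shadedHead S.shadedTail)ᵀ *ᵥ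
      (fun k => (S.sign k : ZMod n) * (u (S.shadedHead k) - u (S.shadedTail k))) = 0) :
    ∃ v : {R // ¬ S.shaded R} → ZMod n, ∀ k,
      (S.sign k : ZMod n) * (u (S.shadedHead k) - u (S.shadedTail k)) =
        v (S.unshadedHead k) - v (S.unshadedTail k) := by
  obtain ⟨v, hv⟩ := exists_incidence_mulVec_eq S.unshaded_connected S.shaded_connected
    S.card_checkerboard (S.shaded_divergence_unshaded_coboundary ℤ) _ hu
  exact ⟨v, fun k => (congrFun hv k).symm.trans (incidence_mulVec _ _ v k)⟩

end Checkerboard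

end KnotDiagram

/-! ### The isomorphism between the null spaces -/

namespace KnotDiagram

open Matrix
open scoped Classical

section Coloring

variable {m : ℕ} (D : KnotDiagram (m + 1)) (σ : Fin (m + 1) ≃ D.Strand) (ε : Fin (m + 1) → ℤˣ)

theorem preColoringMatrix_mulVec {R : Type*} [CommRing R] (x : D.Strand → R) (k : Fin (m + 1)) :
    ∑ a, (D.preColoringMatrix σ ε k a : R) * x (σ a) =
      (ε k : ℤ) * (x (D.strand (k, 0)) + x (D.strand (k, 2)) - 2 * x (D.strand (k, 1))) := by
  refine (Equiv.sum_comp σ (fun s => (((ε k : ℤ) * ((if s = D.strand (k, 0) then 1 else 0) +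
    (if s = D.strand (k, 2) then 1 else 0) - 2 * (if s = D.strand (k, 1) then 1 else 0)) : ℤ) : R) *
      x s)).trans ?_
  push_cast
  simp only [mul_assoc, ← Finset.mul_sum, add_mul, sub_mul, Finset.sum_add_distrib,
    Finset.sum_sub_distrib, ite_mul, one_mul, zero_mul, Finset.sum_ite_eq', Finset.mem_univ,
    if_true]

theorem mem_nul_preColoringMatrix_iff {n : ℕ} (x : D.Strand → ZMod n) :
    (fun a => x (σ a)) ∈ nul n (D.preColoringMatrix σ ε) ↔
      ∀ k, x (D.strand (k, 0)) + x (D.strand (k, 2)) - 2 * x (D.strand (k, 1)) = 0 := by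
  rw [mem_nul]
  refine forall_congr' fun k => ?_
  rw [D.preColoringMatrix_mulVec σ ε x k]
  exact (((ε k).isUnit.map (Int.castRingHom (ZMod n)))).mul_right_eq_zero

theorem sum_preColoringMatrix_row (k : Fin (m + 1)) : ∑ a, D.preColoringMatrix σ ε k a = 0 := by
  have := D.preColoringMatrix_mulVec σ ε (fun _ => (1 : ℤ)) k
  simp only [Int.cast_id, mul_one] at this
  rw [this]
  ring

theorem Checkerboard.sum_preColoringMatrix_column {D : KnotDiagram (m + 1)} (S : D.Checkerboard)
    (σ : Fin (m + 1) ≃ D.Strand) (a : Fin (m + 1)) :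
    ∑ k, ((S.signUnit k * ε k : ℤˣ) : ℤ) * D.preColoringMatrix σ ε k a = 0 := by
  have := S.sum_sign_mul_eq_zero (R := ℤ) (x := fun d => if σ a = D.strand d then 1 else 0)
    (fun d => by rw [D.strand_edge]) (fun k => by rw [D.strand_three])
  rw [← this]
  refine Finset.sum_congr rfl fun k _ => ?_
  have hε : (ε k : ℤ) * ε k = 1 := by rw [← Units.val_mul, Int.units_mul_self, Units.val_one]
  rw [preColoringMatrix, Matrix.of_apply, Units.val_mul, S.coe_signUnit, Int.cast_id]
  linear_combination (S.sign k * ((if σ a = D.strand (k, 0) then 1 else 0) +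
    (if σ a = D.strand (k, 2) then 1 else 0) - 2 * (if σ a = D.strand (k, 1) then 1 else 0))) * hε

end Coloring

section RegionValues

variable {c : ℕ} (D : KnotDiagram c) {R : Type*} [CommRing R]

/-- The color of a strand that is induced by values on the regions: the sum of the values on the two
sides of an edge of the strand. By `strandColor_strand` the choice of the edge does not matter if
the values solve the crossing equations. -/
noncomputable def strandColor (h : D.Region → R) (s : D.Strand) : R :=
  h (D.region s.out) + h (D.region (D.edge s.out))

/-- The crossing equations for values on the regions: the sums of the values on the two sides of the
overpass agree before and after the crossing. -/
def DehnEquations (h : D.Region → R) : Prop :=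
  ∀ k, h (D.region (k, 0)) + h (D.region (k, 1)) = h (D.region (k, 2)) + h (D.region (k, 3))

variable {D}

theorem strandColor_strand {h : D.Region → R} (hh : D.DehnEquations h) (d : Dart c) :
    D.strandColor h (D.strand d) = h (D.region d) + h (D.region (D.edge d)) := by
  refine D.strand_lift_eq (x := fun d => h (D.region d) + h (D.region (D.edge d)))
    (fun d => by rw [D.edge_edge, add_comm]) (fun k => ?_) (Quotient.out_eq (D.strand d))
  have := hh k
  rw [D.region_edge, D.region_edge, show (3 : ZMod 4) - 1 = 2 from rfl, sub_self]
  linear_combination -this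

theorem strandColor_equation {h : D.Region → R} (hh : D.DehnEquations h) (k : Fin c) :
    D.strandColor h (D.strand (k, 0)) + D.strandColor h (D.strand (k, 2)) -
      2 * D.strandColor h (D.strand (k, 1)) = 0 := by
  simp only [strandColor_strand hh, D.region_edge]
  rw [show (0 : ZMod 4) - 1 = 3 from rfl, show (2 : ZMod 4) - 1 = 1 from rfl, sub_self]
  linear_combination -hh k

/-- The values on the regions at the ends of an arc determine the alternating sum of the colors of
the strands that it crosses. -/
theorem Arc.altSum_eq {A : Type} [AddCommGroup A] (S : D.Checkerboard) {x : D.Strand → A}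
    {h : D.Region → A} (hx : ∀ d, x (D.strand d) = h (D.region d) + h (D.region (D.edge d)))
    {Q Q' : D.Region} (γ : D.Arc Q Q') :
    γ.altSum x = h Q - if S.shaded Q ↔ S.shaded Q' then h Q' else - h Q' := by
  induction γ with
  | nil Q => simp [altSum]
  | @cross d Q' γ ih =>
    have hd := S.shaded_edge d
    rw [altSum, ih, hx]
    by_cases h1 : S.shaded (D.region d) <;> by_cases h2 : S.shaded Q' <;> simp [hd, h1, h2] <;> abel

variable (D R) in
/-- The solutions of the crossing equations for values on the regions that vanish on the region `Q`
and induce the color `0` on the strand `s`. -/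
noncomputable def dehnSpace (Q : D.Region) (s : D.Strand) : Submodule R (D.Region → R) where
  carrier := {h | D.DehnEquations h ∧ h Q = 0 ∧ D.strandColor h s = 0}
  add_mem' := by
    rintro h h' ⟨h1, h2, h3⟩ ⟨h1', h2', h3'⟩
    refine ⟨fun k => ?_, by simp [h2, h2'], ?_⟩
    · simp only [Pi.add_apply]
      linear_combination h1 k + h1' k
    · simp only [strandColor, Pi.add_apply] at h3 h3' ⊢
      linear_combination h3 + h3'
  zero_mem' := ⟨fun k => by simp, rfl, by simp [strandColor]⟩
  smul_mem' := by
    rintro r h ⟨h1, h2, h3⟩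
    refine ⟨fun k => ?_, by simp [h2], ?_⟩
    · simp only [Pi.smul_apply, smul_eq_mul]
      linear_combination r * h1 k
    · simp only [strandColor, Pi.smul_apply, smul_eq_mul] at h3 ⊢
      linear_combination r * h3

end RegionValues

theorem cons_zero_comp_succ {A : Type*} [Zero A] {m : ℕ} {f : Fin (m + 1) → A} (hf : f 0 = 0) :
    (Fin.cons (α := fun _ => A) 0 fun i => f i.succ : Fin (m + 1) → A) = f := by
  rw [← hf]
  exact Fin.cons_self_tail f

section Isomorphisms

variable {m t : ℕ} {D : KnotDiagram (m + 1)} (S : D.Checkerboard)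
  (σ : Fin (m + 1) ≃ D.Strand) (ε : Fin (m + 1) → ℤˣ)
  (ρ : Fin (t + 1) ≃ {R : D.Region // S.shaded R}) (n : ℕ)

/-- Region values induce strand colors that solve the reduced coloring equations. -/
noncomputable def Checkerboard.toColoring :
    D.dehnSpace (ZMod n) (ρ 0).1 (σ 0) →ₗ[ZMod n]
      nul n (deleteFirst (D.preColoringMatrix σ ε)) where
  toFun h := ⟨fun a => D.strandColor h.1 (σ a.succ), by
    rw [← cons_zero_mem_nul_iff _ (S.sum_preColoringMatrix_column ε σ),
      cons_zero_comp_succ (f := fun a => D.strandColor h.1 (σ a)) h.2.2.2]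
    exact (D.mem_nul_preColoringMatrix_iff σ ε _).mpr (strandColor_equation h.2.1)⟩
  map_add' h h' := by
    ext a
    simp only [strandColor, Submodule.coe_add, Pi.add_apply]
    ring
  map_smul' r h := by
    ext a
    simp only [strandColor, Submodule.coe_smul, Pi.smul_apply, smul_eq_mul, RingHom.id_apply]
    ring

theorem Checkerboard.toColoring_injective : Function.Injective (S.toColoring σ ε ρ n) := by
  rw [injective_iff_map_eq_zero]
  rintro ⟨h, hh, hQ, hs⟩ h0
  have hcol : ∀ s, D.strandColor h s = 0 := fun s => by
    obtain ⟨a, rfl⟩ := σ.surjective s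
    refine Fin.cases hs (fun a => ?_) a
    exact congrFun (congrArg Subtype.val h0) a
  ext Q
  refine S.dual_connected (fun Q => h Q = 0) (fun e => ?_) _ Q hQ
  have := hcol (D.strand e.1)
  rw [strandColor_strand hh] at this
  constructor <;> intro h' <;> simpa [h'] using this

theorem Checkerboard.toColoring_surjective : Function.Surjective (S.toColoring σ ε ρ n) := by
  rintro ⟨v, hv⟩
  rw [← cons_zero_mem_nul_iff _ (S.sum_preColoringMatrix_column ε σ)] at hv
  set x : D.Strand → ZMod n := fun s => (Fin.cons (α := fun _ => ZMod n) 0 v : _ → _) (σ.symm s)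
    with hx
  have hxσ : ∀ a, x (σ a) = (Fin.cons (α := fun _ => ZMod n) 0 v : _ → _) a := fun a => by
    rw [hx]; simp only [Equiv.symm_apply_apply]
  have heq := (D.mem_nul_preColoringMatrix_iff σ ε x).mp (by simp only [hxσ]; exact hv)
  obtain ⟨g, hg⟩ := S.exists_region_values (x := fun d => x (D.strand d))
    (fun d => by rw [D.strand_edge]) (fun k => by rw [D.strand_three]) heq
  -- shift the values on shaded and unshaded regions in opposite directions
  let h : D.Region → ZMod n := fun Q => if S.shaded Q then g Q - g (ρ 0).1 else g Q + g (ρ 0).1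
  have hsum : ∀ d, h (D.region d) + h (D.region (D.edge d)) = x (D.strand d) := fun d => by
    have hd := S.shaded_edge d
    rw [← hg d]
    by_cases h1 : S.shaded (D.region d) <;> simp [h, hd, h1]
  have hh : D.DehnEquations h := fun k => by
    have h1 := hsum (k, 1)
    have h3 := hsum (k, 3)
    rw [D.strand_three] at h3
    rw [D.region_edge, sub_self] at h1
    rw [D.region_edge, show (3 : ZMod 4) - 1 = 2 from rfl] at h3
    linear_combination h1 - h3
  have hcol : ∀ s, D.strandColor h s = x s := fun s => by
    obtain ⟨d, rfl⟩ := Quotient.exists_rep s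
    exact (strandColor_strand hh d).trans (hsum d)
  refine ⟨⟨h, hh, by simp [h, (ρ 0).2], by rw [hcol, hxσ]; rfl⟩, Subtype.ext (funext fun a => ?_)⟩
  exact (hcol _).trans ((hxσ _).trans (Fin.cons_succ _ _ _))

theorem Checkerboard.mem_nul_preGoeritzMatrix_iff {u : {R : D.Region // S.shaded R} → ZMod n} :
    (fun i => u (ρ i)) ∈ nul n (S.preGoeritzMatrix ρ) ↔
      (incidence (ZMod n) S.shadedHead S.shadedTail)ᵀ *ᵥ
        (fun k => (S.sign k : ZMod n) * (u (S.shadedHead k) - u (S.shadedTail k))) = 0 := by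
  rw [mem_nul, funext_iff, ← ρ.forall_congr_right]
  refine forall_congr' fun i => ?_
  rw [S.preGoeritzMatrix_mulVec, neg_eq_zero, Pi.zero_apply]

theorem Checkerboard.sum_preGoeritzMatrix_row (i : Fin (t + 1)) :
    ∑ j, S.preGoeritzMatrix ρ i j = 0 := by
  have := S.preGoeritzMatrix_mulVec ρ (fun _ => (1 : ℤ)) i
  simpa [incidence_transpose_mulVec] using this

theorem Checkerboard.preGoeritzMatrix_symm (i j : Fin (t + 1)) :
    S.preGoeritzMatrix ρ i j = S.preGoeritzMatrix ρ j i := by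
  have hmeet : ∀ k Q Q', D.MeetAt k Q Q' → D.MeetAt k Q' Q := by
    rintro k Q Q' ⟨a, h1, h2⟩
    refine ⟨a + 2, h2, ?_⟩
    rw [add_assoc, show (2 : ZMod 4) + 2 = 0 from rfl, add_zero]
    exact h1
  have hentry : ∀ Q Q', S.goeritzEntry Q Q' = S.goeritzEntry Q' Q := fun Q Q' => by
    refine Finset.sum_congr rfl fun k _ => ?_
    simp only [show D.MeetAt k Q Q' ↔ D.MeetAt k Q' Q from ⟨hmeet _ _ _, hmeet _ _ _⟩]
  by_cases hij : i = j
  · rw [hij]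
  · simp only [preGoeritzMatrix, Matrix.of_apply, if_neg hij, if_neg (Ne.symm hij)]
    exact hentry _ _

theorem Checkerboard.sum_preGoeritzMatrix_column (j : Fin (t + 1)) :
    ∑ i, (((fun _ => 1 : Fin (t + 1) → ℤˣ) i : ℤˣ) : ℤ) * S.preGoeritzMatrix ρ i j = 0 := by
  simp only [Units.val_one, one_mul]
  simp_rw [S.preGoeritzMatrix_symm ρ _ j]
  exact S.sum_preGoeritzMatrix_row ρ j

/-- The negatives of the values on the shaded regions solve the reduced Goeritz equations. -/
noncomputable def Checkerboard.toGoeritz :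
    D.dehnSpace (ZMod n) (ρ 0).1 (σ 0) →ₗ[ZMod n]
      nul n (deleteFirst (S.preGoeritzMatrix ρ)) where
  toFun h := ⟨fun i => - h.1 (ρ i.succ).1, by
    rw [← cons_zero_mem_nul_iff _ (S.sum_preGoeritzMatrix_column ρ),
      cons_zero_comp_succ (f := fun i => - h.1 (ρ i).1) (by rw [h.2.2.1, neg_zero])]
    refine Submodule.neg_mem _
      ((S.mem_nul_preGoeritzMatrix_iff ρ n (u := fun r => h.1 r.1)).mpr ?_)
    have h1 : (fun k => (S.sign k : ZMod n) * (h.1 (S.shadedHead k) - h.1 (S.shadedTail k))) =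
        incidence (ZMod n) S.unshadedHead S.unshadedTail *ᵥ fun r => h.1 r.1 := by
      ext k
      rw [incidence_mulVec]
      exact (S.dehn_equation_iff h.1 k).mp (h.2.1 k)
    rw [h1, mulVec_mulVec, S.shaded_divergence_unshaded_coboundary, zero_mulVec]⟩
  map_add' h h' := by
    ext i
    simp only [Submodule.coe_add, Pi.add_apply]
    ring
  map_smul' r h := by
    ext i
    simp only [Submodule.coe_smul, Pi.smul_apply, smul_eq_mul, RingHom.id_apply]
    ring

theorem Checkerboard.toGoeritz_injective : Function.Injective (S.toGoeritz σ ρ n) := by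
  rw [injective_iff_map_eq_zero]
  rintro ⟨h, hh, hQ, hs⟩ h0
  have hshaded : ∀ r : {R : D.Region // S.shaded R}, h r = 0 := fun r => by
    obtain ⟨i, rfl⟩ := ρ.surjective r
    refine Fin.cases hQ (fun i => ?_) i
    exact neg_eq_zero.mp (congrFun (congrArg Subtype.val h0) i)
  -- the values on unshaded regions are constant, and the color of `σ 0` shows the constant is zero
  have hun : ∀ r : {R : D.Region // ¬ S.shaded R}, h r = 0 := by
    obtain ⟨d, hd⟩ : ∃ d, D.strand d = σ 0 := Quotient.exists_rep (σ 0)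
    rw [← hd, strandColor_strand hh] at hs
    have hd' := S.shaded_edge d
    have hbase : ∃ r : {R : D.Region // ¬ S.shaded R}, h r = 0 := by
      by_cases h1 : S.shaded (D.region d)
      · refine ⟨⟨_, mt hd'.mp (not_not.mpr h1)⟩, ?_⟩
        simpa [hshaded ⟨_, h1⟩] using hs
      · refine ⟨⟨_, h1⟩, ?_⟩
        simpa [hshaded ⟨_, hd'.mpr h1⟩] using hs
    obtain ⟨r₀, hr₀⟩ := hbase
    refine fun r => S.unshaded_connected (fun r => h r = 0) (fun k => ?_) r₀ r hr₀
    have := (S.dehn_equation_iff h k).mp (hh k)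
    rw [hshaded, hshaded, sub_self, mul_zero, eq_comm, sub_eq_zero] at this
    rw [this]
  ext Q
  by_cases h1 : S.shaded Q
  · exact hshaded ⟨Q, h1⟩
  · exact hun ⟨Q, h1⟩

theorem Checkerboard.toGoeritz_surjective : Function.Surjective (S.toGoeritz σ ρ n) := by
  rintro ⟨w, hw⟩
  rw [← cons_zero_mem_nul_iff _ (S.sum_preGoeritzMatrix_column ρ)] at hw
  set u : {R : D.Region // S.shaded R} → ZMod n :=
    fun r => - (Fin.cons (α := fun _ => ZMod n) 0 w : _ → _) (ρ.symm r) with hu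
  have huρ : ∀ i, u (ρ i) = - (Fin.cons (α := fun _ => ZMod n) 0 w : _ → _) i := fun i => by
    rw [hu]; simp only [Equiv.symm_apply_apply]
  obtain ⟨v, hv⟩ := S.exists_unshaded_values (n := n) (u := u)
    ((S.mem_nul_preGoeritzMatrix_iff ρ n).mp (by simp only [huρ]; exact Submodule.neg_mem _ hw))
  -- a common shift `q` of the values on unshaded regions remains free
  let h : ZMod n → D.Region → ZMod n := fun q Q =>
    if hQ : S.shaded Q then u ⟨Q, hQ⟩ else v ⟨Q, hQ⟩ + q
  have hsh : ∀ q (r : {R : D.Region // S.shaded R}), h q r = u r := fun q r => by simp [h, r.2]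
  have hun : ∀ q (r : {R : D.Region // ¬ S.shaded R}), h q r = v r + q := fun q r => by
    simp [h, r.2]
  have hh : ∀ q, D.DehnEquations (h q) := fun q k => by
    rw [S.dehn_equation_iff, hsh, hsh, hun, hun, hv]
    ring
  obtain ⟨q, hq⟩ : ∃ q, D.strandColor (h q) (σ 0) = 0 := by
    obtain ⟨d, hd⟩ : ∃ d, D.strand d = σ 0 := Quotient.exists_rep (σ 0)
    simp_rw [← hd, strandColor_strand (hh _)]
    have hd' := S.shaded_edge d
    by_cases h1 : S.shaded (D.region d)
    · have h2 := mt hd'.mp (not_not.mpr h1)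
      refine ⟨-(u ⟨_, h1⟩ + v ⟨_, h2⟩), ?_⟩
      simp only [h, dif_pos h1, dif_neg h2]
      ring
    · have h2 := hd'.mpr h1
      refine ⟨-(v ⟨_, h1⟩ + u ⟨_, h2⟩), ?_⟩
      simp only [h, dif_neg h1, dif_pos h2]
      ring
  refine ⟨⟨h q, hh q, ?_, hq⟩, Subtype.ext (funext fun i => ?_)⟩
  · rw [hsh, huρ, Fin.cons_zero, neg_zero]
  · change - h q (ρ i.succ).1 = w i
    rw [hsh, huρ, Fin.cons_succ, neg_neg]

/-- The isomorphism from the reduced colorings to the solutions of the reduced Goeritz equations: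
both are isomorphic to the space of normalized region values. -/
noncomputable def Checkerboard.coloringEquivGoeritz :
    nul n (deleteFirst (D.preColoringMatrix σ ε)) ≃ₗ[ZMod n]
      nul n (deleteFirst (S.preGoeritzMatrix ρ)) :=
  (LinearEquiv.ofBijective (S.toColoring σ ε ρ n)
    ⟨S.toColoring_injective σ ε ρ n, S.toColoring_surjective σ ε ρ n⟩).symm.trans
  (LinearEquiv.ofBijective (S.toGoeritz σ ρ n)
    ⟨S.toGoeritz_injective σ ρ n, S.toGoeritz_surjective σ ρ n⟩)

theorem Checkerboard.coloringEquivGoeritz_toColoring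
    (h : D.dehnSpace (ZMod n) (ρ 0).1 (σ 0)) :
    S.coloringEquivGoeritz σ ε ρ n (S.toColoring σ ε ρ n h) = S.toGoeritz σ ρ n h := by
  have : (LinearEquiv.ofBijective (S.toColoring σ ε ρ n)
    ⟨S.toColoring_injective σ ε ρ n, S.toColoring_surjective σ ε ρ n⟩).symm
      (S.toColoring σ ε ρ n h) = h := by
    rw [LinearEquiv.symm_apply_eq]
    rfl
  rw [coloringEquivGoeritz, LinearEquiv.trans_apply, this]
  rfl

theorem Checkerboard.altSum_eq_sub (v : nul n (deleteFirst (D.preColoringMatrix σ ε)))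
    (x : D.Strand → ZMod n) (w : Fin (t + 1) → ZMod n)
    (hx : ∀ a, x (σ a) = Fin.cons (α := fun _ => ZMod n) 0 v.1 a)
    (hw : w = Fin.cons (α := fun _ => ZMod n) 0 (S.coloringEquivGoeritz σ ε ρ n v).1)
    (i j : Fin (t + 1)) (γ : D.Arc (ρ i).1 (ρ j).1) : γ.altSum x = w j - w i := by
  obtain ⟨⟨h, hh, hQ, hs⟩, rfl⟩ := S.toColoring_surjective σ ε ρ n v
  rw [S.coloringEquivGoeritz_toColoring] at hw
  have hwh : ∀ i, w i = - h (ρ i).1 := fun i => by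
    have h0 : - h (ρ 0).1 = 0 := by rw [hQ, neg_zero]
    exact congrFun (hw.trans (cons_zero_comp_succ (f := fun i => - h (ρ i).1) h0)) i
  have hxh : ∀ d, x (D.strand d) = h (D.region d) + h (D.region (D.edge d)) := fun d => by
    rw [← strandColor_strand hh, ← σ.apply_symm_apply (D.strand d), hx]
    exact congrFun (cons_zero_comp_succ (f := fun a => D.strandColor h (σ a)) hs) _
  rw [γ.altSum_eq S hxh, if_pos (iff_of_true (ρ i).2 (ρ j).2), hwh, hwh]
  ring

end Isomorphisms

end KnotDiagram

theorem theorem1 {m t : ℕ} (D : KnotDiagram (m + 1)) (S : D.Checkerboard) :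
    Nat.card D.Strand = m + 1 ∧
    ∀ (σ : Fin (m + 1) ≃ D.Strand) (ε : Fin (m + 1) → ℤˣ)
      (ρ : Fin (t + 1) ≃ {R : D.Region // S.shaded R})
      (C' : Matrix (Fin (m + 1)) (Fin (m + 1)) ℤ) (C : Matrix (Fin m) (Fin m) ℤ)
      (G' : Matrix (Fin (t + 1)) (Fin (t + 1)) ℤ) (G : Matrix (Fin t) (Fin t) ℤ),
      C' = D.preColoringMatrix σ ε → C = deleteFirst C' →
      G' = S.preGoeritzMatrix ρ → G = deleteFirst G' →
      (∀ n : ℕ,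
        -- deleting the first entry is a bijection from (i) to (ii), and from (iv) to (iii)
        Set.BijOn Fin.tail {v | v ∈ nul n C' ∧ v 0 = 0 ∧ v ≠ 0} {v | v ∈ nul n C ∧ v ≠ 0} ∧
        Set.BijOn Fin.tail {w | w ∈ nul n G' ∧ w 0 = 0 ∧ w ≠ 0} {w | w ∈ nul n G ∧ w ≠ 0} ∧
        -- a linear bijection between the null spaces, which matches (ii) with (iii), and
        -- under which the differences of a coloring are the differences of the region values
        (∃ Φ : nul n C ≃ₗ[ZMod n] nul n G,
          Set.BijOn Φ {v | (v : Fin m → ZMod n) ≠ 0} {w | (w : Fin t → ZMod n) ≠ 0} ∧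
          ∀ (v : nul n C) (x : D.Strand → ZMod n) (w : Fin (t + 1) → ZMod n),
            (∀ a, x (σ a) = Fin.cons (α := fun _ => ZMod n) 0 v.1 a) →
            w = Fin.cons (α := fun _ => ZMod n) 0 (Φ v).1 →
            ∀ (i j : Fin (t + 1)) (γ : D.Arc (ρ i).1 (ρ j).1), γ.altSum x = w j - w i) ∧
        (n.Prime →
          Module.finrank (ZMod n) (nul n C) = Module.finrank (ZMod n) (nul n G))) ∧
      -- the coloring determinant equals the Goeritz determinant, whichever rows and columns
      -- are deleted
      (∀ (k a : Fin (m + 1)) (i j : Fin (t + 1)),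
        |(C'.submatrix k.succAbove a.succAbove).det| =
          |(G'.submatrix i.succAbove j.succAbove).det|) := by

  refine ⟨S.card_strand, ?_⟩
  rintro σ ε ρ C' C G' G rfl rfl rfl rfl
  refine ⟨fun n => ⟨bijOn_tail_nul _ (S.sum_preColoringMatrix_column ε σ),
    bijOn_tail_nul _ (S.sum_preGoeritzMatrix_column ρ),
    ⟨S.coloringEquivGoeritz σ ε ρ n, ?_, S.altSum_eq_sub σ ε ρ n⟩,
    fun _ => (S.coloringEquivGoeritz σ ε ρ n).finrank_eq⟩, fun k a i j => ?_⟩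
  · have hne : ∀ v, (S.coloringEquivGoeritz σ ε ρ n v : Fin t → ZMod n) ≠ 0 ↔
        (v : Fin m → ZMod n) ≠ 0 := fun v => by simp
    exact ⟨fun v hv => (hne v).mpr hv, (S.coloringEquivGoeritz σ ε ρ n).injective.injOn,
      fun w hw => ⟨(S.coloringEquivGoeritz σ ε ρ n).symm w,
        (hne _).mp (by rwa [LinearEquiv.apply_symm_apply]), LinearEquiv.apply_symm_apply _ w⟩⟩
  · rw [abs_det_submatrix_succAbove_eq _ _ (S.sum_preColoringMatrix_column ε σ)
        (D.sum_preColoringMatrix_row σ ε),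
      abs_det_submatrix_succAbove_eq _ _ (S.sum_preGoeritzMatrix_column ρ)
        (S.sum_preGoeritzMatrix_row ρ)]
    exact abs_det_eq_of_nul_equiv _ _ fun n => ⟨S.coloringEquivGoeritz σ ε ρ n⟩
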